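/- **Setting.** Let $d\ge 2$ and let $\{|i\rangle\}_{i=1}^d$ be the standard basis of $\mathbb C^d$. For $U\in SU(d)$ let $E^{(U)}_i=U|i\rangle\langle i|U^\dagger$, a von Neumann measurement, and let $E^{(U)}_{CD}=\sum_i (E^{(U)}_i)^T\otimes|i\rangle\langle i|$ be the Choi operator on $\mathcal H_C\otimes\mathcal H_D$ of the channel $\rho\mapsto\sum_i \mathrm{Tr}[E^{(U)}_i\rho]\,|i\rangle\langle i|$ from $C$ to $D$. All systems $A,B,C,D$ have dimension $d$. A *$1\to2$ learning strategy* (the measurement is used once, before the bipartite state on $AB$ is available) is a generalized instrument: a family $\mathbf R=\{R_{ij}\}_{i,j=1}^d$ of positive operators on $\mathcal H_A\otimes\mathcal H_B\otimes\mathcal H_C\otimes\mathcal H_D$ with $\sum_{i,j}R_{ij}=I_{ABD}\otimes\rho_C$ for some $\rho\ge0$, $\mathrm{Tr}\,\rho=1$. Its replicated POVM is $G^{(U)}_{ij}=[R_{ij}*E^{(U)}_{CD}]^T$, where $R*E=\mathrm{Tr}_{CD}[R^{\theta_{CD}}(I_{AB}\otimes E)]$ is the link product ($\theta_{CD}$ is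 partial transposition on $CD$). Its fidelity is $$F[\mathbf R]=\frac1{d^2}\sum_{i,j}\int_{SU(d)}dU\;\mathrm{Tr}\big[G^{(U)}_{ij}(E^{(U)}_i\otimes E^{(U)}_j)\big],$$ with $dU$ the normalized Haar measure. **Optimal fidelity.** The maximum of $F[\mathbf R]$ over all $1\to2$ learning strategies is attained. It equals $$\frac{9d^2+16d-17}{6d^2(d^2-1)}\quad\text{for } d\ge3,\qquad \frac7{12}\quad\text{for } d=2,$$ and it is asymptotically equivalent to $\frac{3}{2d^2}$ as $d\to\infty$. **Optimal instrument.** Let $P^\pm$ be the projections onto the symmetric and the antisymmetric subspace of $\mathcal H_A\otimes\mathcal H_B$, and let $\Psi^\pm_m=\big(|\omega\rangle_{AC}|m\rangle_B\pm|m\rangle_A|\omega\rangle_{BC}\big)/\sqrt{2(d\pm1)}$ with $|\omega\rangle=\sum_n|n\rangle|n\rangle$. For a $2\times2$ matrix $r$ indexed by $\{+,-\}$ put $P^\alpha\otimes r=\sum_{a,b}r_{ab}\sum_m|\Psi^a_m\rangle\langle\Psi^b_m|$. Put $P^\beta=P^+\otimes I_C-\sum_m|\Psi^+_m\rangle\langle\Psi^+_m|$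 and $P^\gamma=P^-\otimes I_C-\sum_m|\Psi^-_m\rangle\langle\Psi^-_m|$ (which is $0$ for $d=2$). Let $a=\frac{d+1}{18d(d-1)}$. For every $d\ge2$ the maximum is attained by $R_{ij}=\sum_k R'_{ij,k}\otimes|k\rangle\langle k|_D$, where * $R'_{ii,i}=P^\alpha\otimes\begin{pmatrix}\frac1d-2a&0\\0&0\end{pmatrix}$, and $R'_{ii,k}=\frac1{d(d-1)}P^\beta$ for $k\ne i$; * $R'_{ij,i}=\frac1{d-1}P^\alpha\otimes\begin{pmatrix}a&\sqrt{a/2d}\\\sqrt{a/2d}&\frac1{2d}\end{pmatrix}$ and $R'_{ij,j}=\frac1{d-1}P^\alpha\otimes\begin{pmatrix}a&-\sqrt{a/2d}\\-\sqrt{a/2d}&\frac1{2d}\end{pmatrix}$ for $i\ne j$; * $R'_{ij,k}=\frac1{d(d-1)(d-2)}P^\gamma$ for $i,j,k$ distinct. **Replicated POVM.** For this instrument, every $U\in SU(d)$ and $Q'^\pm=\frac1{\sqrt{9d(d-1)}}(P^+\pm3P^-)$, one has for all $i$ $$G^{(U)}_{ii}=\tfrac{16d-2}{9d(d^2-1)}P^+(E^{(U)}_i\otimes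 I_B)P^++\tfrac{d^2-3}{d(d^2-1)}P^+ ,$$ and for all $i\ne j$, if $d\ge3$, $$G^{(U)}_{ij}=\tfrac1{d-1}\big[Q'^+(E^{(U)}_i\otimes I_B)Q'^++Q'^-(E^{(U)}_j\otimes I_B)Q'^-\big]+\tfrac{2}{d(d-1)^2(d-2)}P^-(E^{(U)}_i\otimes I_B+E^{(U)}_j\otimes I_B)P^-+\tfrac{d-3}{(d-1)^2(d-2)}P^- ;$$ if $d=2$, only the term with $\tfrac1{d-1}[\cdots]$ is present. -/

import Mathlib

open scoped ComplexOrder Kronecker Matrix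

noncomputable section

namespace MeasurementLearning

/-- The group `SU(d)`. -/
abbrev SU (d : ℕ) : Type := ↥(Matrix.specialUnitaryGroup (Fin d) ℂ)

instance instTopologicalGroupSU (d : ℕ) : IsTopologicalGroup (SU d) where
  continuous_mul := by
    refine Continuous.subtype_mk ?_ _
    exact (continuous_subtype_val.comp continuous_fst).matrix_mul
      (continuous_subtype_val.comp continuous_snd)
  continuous_inv := by
    refine continuous_induced_rng.2 ?_
    exact (continuous_subtype_val (p := fun A : Matrix (Fin d) (Fin d) ℂ =>
      A ∈ Matrix.specialUnitaryGroup (Fin d) ℂ)).matrix_conjTranspose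

theorem isCompact_SU (d : ℕ) :
    IsCompact (Matrix.specialUnitaryGroup (Fin d) ℂ : Set (Matrix (Fin d) (Fin d) ℂ)) := by
  have hK : IsCompact (Set.pi Set.univ (fun _ : Fin d => Set.pi Set.univ
      (fun _ : Fin d => Metric.closedBall (0 : ℂ) 1))) :=
    isCompact_univ_pi fun _ => isCompact_univ_pi fun _ => isCompact_closedBall _ _
  refine IsCompact.of_isClosed_subset (t := (Matrix.specialUnitaryGroup (Fin d) ℂ :
    Set (Matrix (Fin d) (Fin d) ℂ))) hK ?_ ?_
  · have : (Matrix.specialUnitaryGroup (Fin d) ℂ : Set (Matrix (Fin d) (Fin d) ℂ)) =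
        {A | A * Aᴴ = 1} ∩ {A | A.det = 1} := by
      ext A
      simp [Matrix.mem_specialUnitaryGroup_iff, Matrix.mem_unitaryGroup_iff,
        Matrix.star_eq_conjTranspose]
    rw [this]
    exact (isClosed_eq (continuous_id.matrix_mul continuous_id.matrix_conjTranspose)
      continuous_const).inter (isClosed_eq continuous_id.matrix_det continuous_const)
  · intro A hA i _ j _
    rw [mem_closedBall_zero_iff]
    exact entry_norm_bound_of_unitary (Matrix.mem_specialUnitaryGroup_iff.1 hA).1 i j

instance instCompactSpaceSU (d : ℕ) : CompactSpace (SU d) :=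
  isCompact_iff_compactSpace.1 (isCompact_SU d)

instance instMeasurableSpaceSU (d : ℕ) : MeasurableSpace (SU d) := borel _

instance instBorelSpaceSU (d : ℕ) : BorelSpace (SU d) := ⟨rfl⟩

/-- The normalized Haar measure on `SU(d)`. -/
def haarSU (d : ℕ) : MeasureTheory.Measure (SU d) := MeasureTheory.Measure.haarMeasure ⊤

/-- Index set of the product basis of `H_A ⊗ H_B`, and of the pairs of outcomes `(i, j)`. -/
abbrev Pair (d : ℕ) : Type := Fin d × Fin d

/-- Index set of the product basis of `(H_A ⊗ H_B) ⊗ (H_C ⊗ H_D)`. -/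
abbrev Four (d : ℕ) : Type := Pair d × Pair d

/-- The von Neumann measurement `E_i^{(U)} = U |i⟩⟨i| U†`. -/
def vonNeumann {d : ℕ} (U : SU d) (i : Fin d) : Matrix (Fin d) (Fin d) ℂ :=
  U.1 * Matrix.single i i 1 * U.1ᴴ

/-- The Choi operator on `H_C ⊗ H_D` of the measure-and-prepare channel
`ρ ↦ ∑ i, Tr[E_i^{(U)} ρ] |i⟩⟨i|` from `C` to `D`. -/
def measurementChoi {d : ℕ} (U : SU d) : Matrix (Pair d) (Pair d) ℂ :=
  ∑ i, (vonNeumann U i)ᵀ ⊗ₖ Matrix.single i i 1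

/-- Transposition of the second tensor factor. -/
def partialTransposeRight {m n : Type} (M : Matrix (m × n) (m × n) ℂ) :
    Matrix (m × n) (m × n) ℂ :=
  Matrix.of fun x y => M (x.1, y.2) (y.1, x.2)

/-- Trace over the second tensor factor. -/
def partialTraceRight {m n : Type} [Fintype n] (M : Matrix (m × n) (m × n) ℂ) : Matrix m m ℂ :=
  Matrix.of fun x y => ∑ k, M (x, k) (y, k)

/-- The link product `R * E = Tr_K [R^{θ_K} (I ⊗ E)]` of an operator `R` on `H ⊗ K` with an
operator `E` on `K`. -/
def linkProduct {m n : Type} [Fintype m] [DecidableEq m] [Fintype n]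
    (R : Matrix (m × n) (m × n) ℂ) (E : Matrix n n ℂ) : Matrix m m ℂ :=
  partialTraceRight (partialTransposeRight R * ((1 : Matrix m m ℂ) ⊗ₖ E))

/-- The replicated bipartite POVM `G_{ij}^{(U)} = [R_{ij} * E_{CD}^{(U)}]ᵀ`. -/
def replicated {d : ℕ} (R : Pair d → Matrix (Four d) (Four d) ℂ) (U : SU d) (p : Pair d) :
    Matrix (Pair d) (Pair d) ℂ :=
  (linkProduct (R p) (measurementChoi U))ᵀ

/-- A `1 → 2` learning strategy, as a generalized instrument of Choi operators `R_{ij}` on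
`H_A ⊗ H_B ⊗ H_C ⊗ H_D`: each `R_{ij}` is positive and `∑ R_{ij} = I_{ABD} ⊗ ρ_C` for a density
operator `ρ`.  (The network first emits `C`, and only later receives `A`, `B` and `D`.) -/
def IsLearningInstrument {d : ℕ} (R : Pair d → Matrix (Four d) (Four d) ℂ) : Prop :=
  (∀ p, (R p).PosSemidef) ∧
    ∃ ρ : Matrix (Fin d) (Fin d) ℂ, ρ.PosSemidef ∧ ρ.trace = 1 ∧
      ∑ p, R p = (1 : Matrix (Pair d) (Pair d) ℂ) ⊗ₖ (ρ ⊗ₖ (1 : Matrix (Fin d) (Fin d) ℂ))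

/-- The fidelity `(1 / dim) ∑ i, Tr[P_i Q_i]` of two POVMs with as many outcomes as the dimension
of the space (it is real for positive operators). -/
def povmFidelity {ι : Type} [Fintype ι] (P Q : ι → Matrix ι ι ℂ) : ℝ :=
  (1 / (Fintype.card ι : ℝ)) * ∑ i, (P i * Q i).trace.re

/-- The figure of merit `F[R]`: the Haar average of the fidelity between the replicated POVM and
`E^{(U)} ⊗ E^{(U)}`. -/
def averageFidelity {d : ℕ} (R : Pair d → Matrix (Four d) (Four d) ℂ) : ℝ :=
  ∫ U, povmFidelity (replicated R U) (fun p => vonNeumann U p.1 ⊗ₖ vonNeumann U p.2) ∂(haarSU d)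

/-- The values of the figure of merit that are attained by `1 → 2` learning strategies. -/
def learningFidelities (d : ℕ) : Set ℝ :=
  {F | ∃ R : Pair d → Matrix (Four d) (Four d) ℂ, IsLearningInstrument R ∧ F = averageFidelity R}

/-! ### The explicit optimal instrument -/

/-- The projection onto the symmetric subspace (`s = 0`) or the antisymmetric subspace (`s = 1`)
of `H_A ⊗ H_B`. -/
def projPM (d : ℕ) (s : Fin 2) : Matrix (Pair d) (Pair d) ℂ :=
  (1 / 2 : ℂ) • (1 + (-1 : ℂ) ^ (s : ℕ) • Matrix.of fun x y => if x = y.swap then 1 else 0)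

/-- The vectors `Ψ^±_m = (|ω⟩_{AC} |m⟩_B ± |m⟩_A |ω⟩_{BC}) / √(2 (d ± 1))`, where
`|ω⟩ = ∑ n, |n⟩|n⟩`; the sign is `+` for `s = 0` and `-` for `s = 1`. -/
def psi (d : ℕ) (s : Fin 2) (m : Fin d) : Pair d × Fin d → ℂ := fun x =>
  ((if x.1.1 = x.2 ∧ x.1.2 = m then 1 else 0) +
      (-1 : ℂ) ^ (s : ℕ) * (if x.1.1 = m ∧ x.1.2 = x.2 then 1 else 0)) /
    ((√(2 * ((d : ℝ) + (-1) ^ (s : ℕ))) : ℝ) : ℂ)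

/-- `P^α ⊗ r = ∑ a b, r_{ab} ∑ m, |Ψ^a_m⟩⟨Ψ^b_m|`, for a `2 × 2` matrix `r`. -/
def alphaBlock (d : ℕ) (r : Matrix (Fin 2) (Fin 2) ℂ) :
    Matrix (Pair d × Fin d) (Pair d × Fin d) ℂ :=
  ∑ a, ∑ b, r a b • ∑ m, Matrix.vecMulVec (psi d a m) (star (psi d b m))

/-- `P^β = P^+ ⊗ I_C - P^α ⊗ |+⟩⟨+|`. -/
def projBeta (d : ℕ) : Matrix (Pair d × Fin d) (Pair d × Fin d) ℂ :=
  projPM d 0 ⊗ₖ (1 : Matrix (Fin d) (Fin d) ℂ) - alphaBlock d !![1, 0; 0, 0]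

/-- `P^γ = P^- ⊗ I_C - P^α ⊗ |-⟩⟨-|`; it is zero for `d = 2`. -/
def projGamma (d : ℕ) : Matrix (Pair d × Fin d) (Pair d × Fin d) ℂ :=
  projPM d 1 ⊗ₖ (1 : Matrix (Fin d) (Fin d) ℂ) - alphaBlock d !![0, 0; 0, 1]

/-- The types of strings `(ij, k)` up to a relabeling of the outcomes. -/
inductive OutcomeClass : Type
  | xxx | xxy | xyx | xyy | xyz

/-- The type of the string `(ij, k)`. -/
def classOf {d : ℕ} (i j k : Fin d) : OutcomeClass :=
  if i = j then (if j = k then .xxx else .xxy)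
  else if i = k then .xyx
  else if j = k then .xyy
  else .xyz

/-- The number of strings `(ij, k)` of the given type (for `d ≥ 2`). -/
def classCard (d : ℕ) : OutcomeClass → ℂ
  | .xxx => d
  | .xxy => d * (d - 1)
  | .xyx => d * (d - 1)
  | .xyy => d * (d - 1)
  | .xyz => d * (d - 1) * (d - 2)

/-- The `2 × 2` matrices `s^α`, with rows and columns in the order `+, -`. -/
def sAlpha (d : ℕ) (a : ℝ) : OutcomeClass → Matrix (Fin 2) (Fin 2) ℂ
  | .xxx => !![1 / (d : ℂ) - 2 * (a : ℂ), 0; 0, 0]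
  | .xxy => 0
  | .xyx => !![(a : ℂ), ((√(a / (2 * (d : ℝ))) : ℝ) : ℂ);
               ((√(a / (2 * (d : ℝ))) : ℝ) : ℂ), 1 / (2 * (d : ℂ))]
  | .xyy => !![(a : ℂ), -((√(a / (2 * (d : ℝ))) : ℝ) : ℂ);
               -((√(a / (2 * (d : ℝ))) : ℝ) : ℂ), 1 / (2 * (d : ℂ))]
  | .xyz => 0

/-- The numbers `s^β`. -/
def sBeta (d : ℕ) : OutcomeClass → ℂ
  | .xxy => 1 / d
  | _ => 0

/-- The numbers `s^γ`. -/
def sGamma (d : ℕ) : OutcomeClass → ℂ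
  | .xyz => 1 / d
  | _ => 0

/-- `R'_{ij,k} = P^α ⊗ r^α + r^β P^β + r^γ P^γ` with `r^ν = (d / n) s^ν`, where `n` is the number
of strings of the type of `(ij, k)`. -/
def diagBlock (d : ℕ) (a : ℝ) (i j k : Fin d) : Matrix (Pair d × Fin d) (Pair d × Fin d) ℂ :=
  ((d : ℂ) / classCard d (classOf i j k)) •
    (alphaBlock d (sAlpha d a (classOf i j k)) + sBeta d (classOf i j k) • projBeta d +
      sGamma d (classOf i j k) • projGamma d)

/-- The instrument `R_{ij} = ∑ k, R'_{ij,k} ⊗ |k⟩⟨k|_D` with parameter `a`. -/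
def learningInstrument (d : ℕ) (a : ℝ) (p : Pair d) : Matrix (Four d) (Four d) ℂ :=
  ∑ k, Matrix.reindex (Equiv.prodAssoc _ _ _) (Equiv.prodAssoc _ _ _)
    (diagBlock d a p.1 p.2 k ⊗ₖ Matrix.single k k (1 : ℂ))

/-- The value `a = (d + 1) / (18 d (d - 1))` of the parameter. -/
def optParam (d : ℕ) : ℝ := ((d : ℝ) + 1) / (18 * d * (d - 1))

/-- `Q'^± = (P^+ ± 3 P^-) / √(9 d (d - 1))`, with `+` for `s = 0` and `-` for `s = 1`. -/
def qPM (d : ℕ) (s : Fin 2) : Matrix (Pair d) (Pair d) ℂ :=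
  (1 / ((√(9 * (d : ℝ) * ((d : ℝ) - 1)) : ℝ) : ℂ)) •
    (projPM d 0 + ((-1 : ℂ) ^ (s : ℕ) * 3) • projPM d 1)

/-- `E_i^{(U)} ⊗ I_B`. -/
def vonNeumannA {d : ℕ} (U : SU d) (i : Fin d) : Matrix (Pair d) (Pair d) ℂ :=
  vonNeumann U i ⊗ₖ (1 : Matrix (Fin d) (Fin d) ℂ)

/-- The part of the replicated POVM elements `G_{ij}^{(U)}`, `i ≠ j`, that is present in every
dimension `d ≥ 2`. -/
def offDiagCore {d : ℕ} (U : SU d) (i j : Fin d) : Matrix (Pair d) (Pair d) ℂ :=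
  (1 / ((d : ℂ) - 1)) •
    (qPM d 0 * vonNeumannA U i * qPM d 0 + qPM d 1 * vonNeumannA U j * qPM d 1)

end MeasurementLearning

end

noncomputable section

namespace MeasurementLearning

open MeasureTheory

/-! The optimization is a semidefinite program, solved by an explicit dual certificate. The Choi
operator of a measurement is diagonal in `D`, so a strategy enters the fidelity only through its
slices `R_{ij,k} = ⟨k|R_{ij}|k⟩_D`, and `F[R] = d⁻² ∑ Tr[R_{ij,k} Ω_{ijk}]`, where `Ω_{ijk}` is the
Haar average of `E_iᵀ ⊗ E_jᵀ ⊗ E_k`. The slices are positive and satisfy `∑_{ij} R_{ij,k} = I_{AB} ⊗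
ρ` for every `k`.

The operators `Ω_{ijk}` commute with `U* ⊗ U* ⊗ U`. They lie in an algebra isomorphic to `M₂ ⊕ ℂ ⊕
ℂ`, with blocks `P^α ⊗ r`, `P^β`, `P^γ`, and depend only on the coincidence pattern of `(i, j, k)`
(`haarOperator_eq`). The map `block` turns products and positivity into statements about `2 × 2`
matrices and two scalars (`block_mul`, `block_posSemidef`).

The dual certificate is a single `Λ` in this algebra with `Λ ≥ Ω_{ijk}` for all `i, j, k`
(`dualOperator_sub_posSemidef`). By covariance `Tr[(I ⊗ ρ) Λ]` depends on `ρ` only through `Tr ρ =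
1` (`trace_kronecker_mul_block`), so the fidelity is a constant minus `d⁻² ∑ Tr[R_{ij,k} (Λ -
Ω_{ijk})]` (`averageFidelity_eq_sub`). This gap is nonnegative for every strategy. It vanishes for
the explicit instrument because each of its slices is annihilated by `Λ - Ω_{ijk}`
(`diagBlock_mul_eq_zero`). No prior symmetrization of strategies is needed.

The Haar moments are obtained from invariance alone. Diagonal unitaries, row permutations and one
reflection determine the third moments of a single outcome up to a scalar, which the trace fixes; `∑
E_k = 1` and relabeling of outcomes then give all mixed moments. -/

/-! ### Haar measure on `SU(d)` and its invariances -/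

instance instIsHaarMeasureHaarSU (d : ℕ) : (haarSU d).IsHaarMeasure := by
  unfold haarSU; infer_instance

instance instIsProbabilityMeasureHaarSU (d : ℕ) : IsProbabilityMeasure (haarSU d) :=
  ⟨by unfold haarSU; exact Measure.haarMeasure_self⟩

/-- A compact group is unimodular: a right translate of the Haar probability measure is again one,
and such a measure is unique. -/
instance instIsMulRightInvariantHaarSU (d : ℕ) : (haarSU d).IsMulRightInvariant where
  map_mul_right_eq_self g := by
    have : IsProbabilityMeasure ((haarSU d).map (· * g)) :=
      Measure.isProbabilityMeasure_map (measurable_mul_const g).aemeasurable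
    exact Measure.isHaarMeasure_eq_of_isProbabilityMeasure _ _

theorem integrable_haarSU {d : ℕ} {f : SU d → ℂ} (hf : Continuous f) :
    Integrable f (haarSU d) :=
  hf.integrable_of_hasCompactSupport (HasCompactSupport.of_compactSpace f)

theorem vonNeumann_apply {d : ℕ} (U : SU d) (i a b : Fin d) :
    vonNeumann U i a b = U.1 a i * star (U.1 b i) := by
  simp [vonNeumann, Matrix.mul_apply, Matrix.single_apply, Finset.sum_ite_eq, ite_and,
    Matrix.conjTranspose_apply]

@[fun_prop]
theorem continuous_vonNeumann_apply {d : ℕ} (i a b : Fin d) :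
    Continuous fun U : SU d => vonNeumann U i a b := by
  have h : ∀ a i : Fin d, Continuous fun U : SU d => U.1 a i := fun a i =>
    (continuous_apply_apply a i).comp continuous_subtype_val
  simp only [vonNeumann_apply]
  exact (h a i).mul (continuous_star.comp (h b i))

theorem sum_vonNeumann {d : ℕ} (U : SU d) : ∑ i, vonNeumann U i = 1 := by
  have h := Matrix.mem_unitaryGroup_iff.1 (Matrix.mem_specialUnitaryGroup_iff.1 U.2).1
  ext a b
  rw [← h, Matrix.sum_apply]
  simp [vonNeumann_apply, Matrix.mul_apply, Matrix.star_apply]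

theorem trace_vonNeumann {d : ℕ} (U : SU d) (i : Fin d) : (vonNeumann U i).trace = 1 := by
  have h := Matrix.mem_unitaryGroup_iff'.1 (Matrix.mem_specialUnitaryGroup_iff.1 U.2).1
  have := congrFun (congrFun h i) i
  simp only [Matrix.mul_apply, Matrix.star_apply, Matrix.one_apply_eq] at this
  rw [← this, Matrix.trace]
  simp [vonNeumann_apply, mul_comm]

/-- A `d`-th root of the conjugate determinant corrects the determinant. The phase cancels in `V E
V†`, so averages over `SU(d)` are invariant under all unitaries, in particular under reflections and
odd permutations. -/
theorem exists_smul_mem_SU {d : ℕ} (hd : 0 < d) {V : Matrix (Fin d) (Fin d) ℂ}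
    (hV : V ∈ Matrix.unitaryGroup (Fin d) ℂ) :
    ∃ (W : SU d) (ζ : ℂ), ζ * star ζ = 1 ∧ W.1 = ζ • V := by
  have hdet := (Matrix.det_of_mem_unitary hV)
  have hdet' := Unitary.mul_star_self_of_mem hdet
  obtain ⟨ζ, hζ⟩ := IsAlgClosed.exists_pow_nat_eq (star V.det) hd
  have h1 : ‖V.det‖ = 1 := by
    have := congrArg norm hdet'
    rw [norm_mul, norm_star, norm_one] at this
    nlinarith [norm_nonneg V.det]
  have h2 : ‖ζ‖ = 1 := by
    have := congrArg norm hζ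
    rw [norm_pow, norm_star, h1] at this
    exact (pow_eq_one_iff_of_nonneg (norm_nonneg _) hd.ne').1 this
  have h3 : ζ * star ζ = 1 := by
    rw [Complex.star_def, Complex.mul_conj, Complex.normSq_eq_norm_sq, h2]; simp
  refine ⟨⟨ζ • V, Matrix.mem_specialUnitaryGroup_iff.2 ⟨?_, ?_⟩⟩, ζ, h3, rfl⟩
  · rw [Matrix.mem_unitaryGroup_iff, star_smul, smul_mul_smul_comm, h3,
      Matrix.mem_unitaryGroup_iff.1 hV, one_smul]
  · rw [Matrix.det_smul, Fintype.card_fin, hζ, mul_comm, hdet']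

/-- The Haar average is invariant under conjugation of the measurement by a unitary. -/
theorem integral_conj_vonNeumann {d : ℕ} (hd : 0 < d) {V : Matrix (Fin d) (Fin d) ℂ}
    (hV : V ∈ Matrix.unitaryGroup (Fin d) ℂ) (f : (Fin d → Matrix (Fin d) (Fin d) ℂ) → ℂ) :
    ∫ U, f (fun i => V * vonNeumann U i * Vᴴ) ∂(haarSU d) =
      ∫ U, f (fun i => vonNeumann U i) ∂(haarSU d) := by
  obtain ⟨W, ζ, hζ, hW⟩ := exists_smul_mem_SU hd hV
  rw [← integral_mul_left_eq_self (fun U => f (fun i => vonNeumann U i)) W]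
  congr 1
  funext U
  congr 1
  funext i
  rw [vonNeumann, vonNeumann, Submonoid.coe_mul, hW, Matrix.conjTranspose_mul,
    Matrix.conjTranspose_smul]
  simp only [Matrix.smul_mul, Matrix.mul_smul, smul_smul, Matrix.mul_assoc]
  rw [mul_comm, hζ, one_smul]

/-- The Haar average is invariant under a relabeling of the outcomes. -/
theorem integral_perm_vonNeumann {d : ℕ} (hd : 0 < d) (σ : Equiv.Perm (Fin d))
    (f : (Fin d → Matrix (Fin d) (Fin d) ℂ) → ℂ) :
    ∫ U, f (fun i => vonNeumann U (σ i)) ∂(haarSU d) =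
      ∫ U, f (fun i => vonNeumann U i) ∂(haarSU d) := by
  have hV : σ⁻¹.permMatrix ℂ ∈ Matrix.unitaryGroup (Fin d) ℂ := by
    rw [Matrix.mem_unitaryGroup_iff, Matrix.star_eq_conjTranspose, Matrix.conjTranspose_permMatrix,
      ← Matrix.permMatrix_mul]
    simp
  obtain ⟨W, ζ, hζ, hW⟩ := exists_smul_mem_SU hd hV
  rw [← integral_mul_right_eq_self (fun U => f (fun i => vonNeumann U i)) W]
  congr 1
  funext U
  congr 1
  funext i
  ext a b
  -- Right multiplication by a permutation matrix permutes the columns of `U`, hence the outcomes.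
  have key : ∀ a, (U * W).1 a i = ζ * U.1 a (σ i) := by
    intro a
    rw [Submonoid.coe_mul, hW, Matrix.mul_smul, Matrix.smul_apply, smul_eq_mul, Equiv.Perm.permMatrix,
      PEquiv.mul_toMatrix_toPEquiv]
    rfl
  rw [vonNeumann_apply, vonNeumann_apply, key, key, star_mul']
  linear_combination (-(U.1 a (σ i) * star (U.1 b (σ i)))) * hζ

/-! ### Symmetries of the third moments -/

/-- The Haar average of a product of three entries of measurement operators. -/
def haarMoment {d : ℕ} (i j k a a' b b' c c' : Fin d) : ℂ :=
  ∫ U, vonNeumann U i a a' * vonNeumann U j b b' * vonNeumann U k c c' ∂(haarSU d)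

theorem haarMoment_diagonal {d : ℕ} (hd : 0 < d) {φ : Fin d → ℂ} (hφ : ∀ a, φ a * star (φ a) = 1)
    (i j k a a' b b' c c' : Fin d) :
    (φ a * φ b * φ c * star (φ a' * φ b' * φ c')) * haarMoment i j k a a' b b' c c' =
      haarMoment i j k a a' b b' c c' := by
  have hV : Matrix.diagonal φ ∈ Matrix.unitaryGroup (Fin d) ℂ := by
    rw [Matrix.mem_unitaryGroup_iff, Matrix.star_eq_conjTranspose, Matrix.diagonal_conjTranspose,
      Matrix.diagonal_mul_diagonal, ← Matrix.diagonal_one]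
    congr 1
    funext a
    exact hφ a
  have h := integral_conj_vonNeumann hd hV (fun E => E i a a' * E j b b' * E k c c')
  simp only [Matrix.diagonal_conjTranspose, Matrix.mul_diagonal, Matrix.diagonal_mul] at h
  unfold haarMoment
  rw [← integral_const_mul]
  refine Eq.trans ?_ h
  congr 1
  funext U
  simp only [Pi.star_apply, star_mul']
  ring

/-- Putting the phase `I` on row `p` multiplies the moment by `I` to the power of the difference of
the two counts. This difference is nonzero and at most three in absolute value, and `I` has order
four, so the factor is not `1`. -/
theorem haarMoment_eq_zero {d : ℕ} (hd : 0 < d) (i j k a a' b b' c c' p : Fin d)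
    (h : (if a = p then 1 else 0) + (if b = p then 1 else 0) + (if c = p then 1 else 0) ≠
      (if a' = p then 1 else 0) + (if b' = p then 1 else 0) + (if c' = p then 1 else 0 : ℕ)) :
    haarMoment i j k a a' b b' c c' = 0 := by
  have hφ : ∀ a, (fun a => if a = p then Complex.I else 1) a *
      star ((fun a => if a = p then Complex.I else 1) a) = 1 := by
    intro a
    by_cases h : a = p <;> simp [h]
  have h1 := haarMoment_diagonal hd hφ i j k a a' b b' c c'
  have h2 : ∀ w : ℂ, w ≠ 1 → ∀ m, w * m = m → m = 0 := by
    intro w hw m hm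
    have : (w - 1) * m = 0 := by linear_combination hm
    exact (mul_eq_zero.1 this).resolve_left (sub_ne_zero.2 hw)
  refine h2 _ ?_ _ h1
  intro h3
  revert h h3
  split_ifs <;> norm_num [Complex.ext_iff]

theorem haarMoment_row_perm {d : ℕ} (hd : 0 < d) (σ : Equiv.Perm (Fin d))
    (i j k a a' b b' c c' : Fin d) :
    haarMoment i j k (σ a) (σ a') (σ b) (σ b') (σ c) (σ c') = haarMoment i j k a a' b b' c c' := by
  have hV : σ.permMatrix ℂ ∈ Matrix.unitaryGroup (Fin d) ℂ := by
    rw [Matrix.mem_unitaryGroup_iff, Matrix.star_eq_conjTranspose, Matrix.conjTranspose_permMatrix,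
      ← Matrix.permMatrix_mul]
    simp
  have key : ∀ (E : Matrix (Fin d) (Fin d) ℂ) (a b : Fin d),
      (σ.permMatrix ℂ * E * (σ.permMatrix ℂ)ᴴ) a b = E (σ a) (σ b) := by
    intro E a b
    rw [Matrix.conjTranspose_permMatrix, Equiv.Perm.permMatrix, Equiv.Perm.permMatrix,
      PEquiv.mul_toMatrix_toPEquiv, PEquiv.toMatrix_toPEquiv_mul]
    rfl
  have h := integral_conj_vonNeumann hd hV (fun E => E i a a' * E j b b' * E k c c')
  simp only [key] at h
  exact h

theorem haarMoment_col_perm {d : ℕ} (hd : 0 < d) (σ : Equiv.Perm (Fin d))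
    (i j k a a' b b' c c' : Fin d) :
    haarMoment (σ i) (σ j) (σ k) a a' b b' c c' = haarMoment i j k a a' b b' c c' :=
  integral_perm_vonNeumann hd σ (fun E => E i a a' * E j b b' * E k c c')

/-- For a single outcome the entries are `u_a ū_{a'}`, so the primed indices may be permuted
independently of the unprimed ones. -/
theorem haarMoment_self_swap {d : ℕ} (i a a' b b' c c' : Fin d) :
    haarMoment i i i a a' b b' c c' = haarMoment i i i a b' b a' c c' := by
  unfold haarMoment
  congr 1; funext U; simp only [vonNeumann_apply]; ring

theorem haarMoment_self_swap' {d : ℕ} (i a a' b b' c c' : Fin d) :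
    haarMoment i i i a a' b b' c c' = haarMoment i i i a a' b c' c b' := by
  unfold haarMoment
  congr 1; funext U; simp only [vonNeumann_apply]; ring

theorem haarMoment_self_comm {d : ℕ} (i a a' b b' c c' : Fin d) :
    haarMoment i i i a a' b b' c c' = haarMoment i i i b b' a a' c c' := by
  unfold haarMoment
  congr 1; funext U; ring

theorem haarMoment_self_comm' {d : ℕ} (i a a' b b' c c' : Fin d) :
    haarMoment i i i a a' b b' c c' = haarMoment i i i a a' c c' b b' := by
  unfold haarMoment
  congr 1; funext U; ring

/-! ### Relations between diagonal moments from a rational reflection -/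

/-- The reflection `1 - (2/5) v vᵀ` for `v = e_a + 2 e_b`. -/
def reflection {d : ℕ} (a b : Fin d) : Matrix (Fin d) (Fin d) ℂ :=
  1 - (2 / 5 : ℂ) • Matrix.vecMulVec (Pi.single a 1 + Pi.single b 2) (Pi.single a 1 + Pi.single b 2)

theorem conjTranspose_reflection {d : ℕ} (a b : Fin d) : (reflection a b)ᴴ = reflection a b := by
  have hv : star (Pi.single a 1 + Pi.single b 2 : Fin d → ℂ) = Pi.single a 1 + Pi.single b 2 := by
    rw [star_add]
    congr 1 <;> (ext i; simp [Pi.single_apply, apply_ite])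
  rw [reflection, Matrix.conjTranspose_sub, Matrix.conjTranspose_smul,
    Matrix.conjTranspose_vecMulVec, hv]
  simp

theorem reflection_mem_unitaryGroup {d : ℕ} {a b : Fin d} (hab : a ≠ b) :
    reflection a b ∈ Matrix.unitaryGroup (Fin d) ℂ := by
  rw [Matrix.mem_unitaryGroup_iff, Matrix.star_eq_conjTranspose, conjTranspose_reflection]
  have hv : (Pi.single a 1 + Pi.single b 2 : Fin d → ℂ) ⬝ᵥ (Pi.single a 1 + Pi.single b 2) = 5 := by
    simp [hab, hab.symm]; norm_num
  rw [reflection, sub_mul, one_mul, mul_sub, mul_one, smul_mul_smul_comm,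
    Matrix.vecMulVec_mul_vecMulVec, hv, Matrix.vecMulVec_smul, smul_smul]
  ext i j
  simp
  ring

theorem reflection_mul_apply {d : ℕ} {a b : Fin d} (hab : a ≠ b) (E : Matrix (Fin d) (Fin d) ℂ)
    (t : Fin d) : (reflection a b * E) a t = (3 / 5) * E a t - (4 / 5) * E b t := by
  rw [reflection, sub_mul, one_mul, Matrix.smul_mul, Matrix.vecMulVec_mul]
  simp [Matrix.vecMulVec_apply, hab, Matrix.add_vecMul]
  ring

theorem reflection_mul_apply_of_ne {d : ℕ} {a b c : Fin d} (hac : c ≠ a) (hbc : c ≠ b)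
    (E : Matrix (Fin d) (Fin d) ℂ) (t : Fin d) : (reflection a b * E) c t = E c t := by
  rw [reflection, sub_mul, one_mul, Matrix.smul_mul, Matrix.vecMulVec_mul]
  simp [Matrix.vecMulVec_apply, hac, hbc]

theorem reflection_conj_apply {d : ℕ} {a b : Fin d} (hab : a ≠ b) (ζ : ℂ)
    (E : Matrix (Fin d) (Fin d) ℂ) :
    (reflection a b * Matrix.diagonal (fun s => if s = b then ζ else 1) * E *
      (reflection a b * Matrix.diagonal (fun s => if s = b then ζ else 1))ᴴ) a a =
      (9 / 25) * E a a - (12 / 25) * ζ * E b a - (12 / 25) * star ζ * E a b +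
        (16 / 25) * (ζ * star ζ) * E b b := by
  have h := fun E t => reflection_mul_apply hab E t
  have h2 : ∀ (M : Matrix (Fin d) (Fin d) ℂ),
      (M * (reflection a b)ᴴ) a a = (3 / 5) * M a a - (4 / 5) * M a b := by
    intro M
    have := h Mᴴ a
    have h3 : (M * (reflection a b)ᴴ) a a = star ((reflection a b * Mᴴ) a a) := by
      rw [← Matrix.conjTranspose_apply, Matrix.conjTranspose_mul, Matrix.conjTranspose_conjTranspose]
    rw [h3, this]
    simp
  rw [Matrix.conjTranspose_mul, ← Matrix.mul_assoc, h2]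
  simp only [Matrix.diagonal_conjTranspose, Matrix.mul_diagonal, Matrix.mul_assoc, h,
    Matrix.diagonal_mul, Pi.star_apply]
  simp [hab]
  ring

theorem reflection_conj_apply_of_ne {d : ℕ} {a b c : Fin d} (hac : c ≠ a) (hbc : c ≠ b) (ζ : ℂ)
    (E : Matrix (Fin d) (Fin d) ℂ) :
    (reflection a b * Matrix.diagonal (fun s => if s = b then ζ else 1) * E *
      (reflection a b * Matrix.diagonal (fun s => if s = b then ζ else 1))ᴴ) c c = E c c := by
  have h := fun E t => reflection_mul_apply_of_ne hac hbc E t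
  have h2 : ∀ (M : Matrix (Fin d) (Fin d) ℂ), (M * (reflection a b)ᴴ) c c = M c c := by
    intro M
    have := h Mᴴ c
    have h3 : (M * (reflection a b)ᴴ) c c = star ((reflection a b * Mᴴ) c c) := by
      rw [← Matrix.conjTranspose_apply, Matrix.conjTranspose_mul, Matrix.conjTranspose_conjTranspose]
    rw [h3, this]
    simp
  rw [Matrix.conjTranspose_mul, ← Matrix.mul_assoc, h2]
  simp only [Matrix.diagonal_conjTranspose, Matrix.mul_diagonal, Matrix.mul_assoc, h,
    Matrix.diagonal_mul, Pi.star_apply]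
  simp [hbc]

theorem integral_reflection {d : ℕ} (hd : 0 < d) {a b : Fin d} (hab : a ≠ b)
    (f : (Fin d → Matrix (Fin d) (Fin d) ℂ) → ℂ) {ζ : ℂ} (hζ : ζ * star ζ = 1) :
    ∫ U, f (fun i => reflection a b * Matrix.diagonal (fun s => if s = b then ζ else 1) *
        vonNeumann U i *
        (reflection a b * Matrix.diagonal (fun s => if s = b then ζ else 1))ᴴ) ∂(haarSU d) =
      ∫ U, f (fun i => vonNeumann U i) ∂(haarSU d) := by
  refine integral_conj_vonNeumann hd (Submonoid.mul_mem _ (reflection_mem_unitaryGroup hab) ?_) f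
  rw [Matrix.mem_unitaryGroup_iff, Matrix.star_eq_conjTranspose, Matrix.diagonal_conjTranspose,
    Matrix.diagonal_mul_diagonal, ← Matrix.diagonal_one]
  congr 1
  funext s
  by_cases h : s = b <;> simp [h]
  simpa using hζ

theorem integral_add_haarSU {d : ℕ} {f g : SU d → ℂ} (hf : Continuous f) (hg : Continuous g) :
    ∫ U, (f U + g U) ∂(haarSU d) = ∫ U, f U ∂(haarSU d) + ∫ U, g U ∂(haarSU d) :=
  integral_add (integrable_haarSU hf) (integrable_haarSU hg)

/-- The minors of a rank one matrix vanish; this removes the off-diagonal entries left by the phase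
average. -/
theorem vonNeumann_mul_swap {d : ℕ} (U : SU d) (i a b : Fin d) :
    vonNeumann U i a b * vonNeumann U i b a = vonNeumann U i a a * vonNeumann U i b b := by
  simp only [vonNeumann_apply]; ring

/-- Averaging over the four phases `1, -1, I, -I`. -/
theorem four_mul_integral {d : ℕ} (hd : 0 < d) {a b : Fin d} (hab : a ≠ b)
    (f : (Fin d → Matrix (Fin d) (Fin d) ℂ) → ℂ)
    (hf : ∀ V : Matrix (Fin d) (Fin d) ℂ,
      Continuous fun U : SU d => f (fun i => V * vonNeumann U i * Vᴴ))
    (g : SU d → ℂ)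
    (hg : ∀ (V : ℂ → Matrix (Fin d) (Fin d) ℂ) (U : SU d),
      (∀ ζ, V ζ = reflection a b * Matrix.diagonal (fun s => if s = b then ζ else 1)) →
      (f fun i => V 1 * vonNeumann U i * (V 1)ᴴ) + (f fun i => V (-1) * vonNeumann U i * (V (-1))ᴴ) +
      (f fun i => V Complex.I * vonNeumann U i * (V Complex.I)ᴴ) +
      (f fun i => V (-Complex.I) * vonNeumann U i * (V (-Complex.I))ᴴ) = 4 * g U) :
    ∫ U, f (fun i => vonNeumann U i) ∂(haarSU d) = ∫ U, g U ∂(haarSU d) := by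
  -- Each phase leaves the integral unchanged, so four copies of it equal the integral of the sum.
  -- For polynomials of degree at most three in the entries the four phases isolate the part of
  -- degree zero in `ζ`.
  have h := fun ζ (hζ : ζ * star ζ = 1) => integral_reflection hd hab f hζ
  have key : (4 : ℂ) * ∫ U, f (fun i => vonNeumann U i) ∂(haarSU d) =
      4 * ∫ U, g U ∂(haarSU d) := by
    rw [← integral_const_mul (4 : ℂ) g]
    simp only [← hg (fun ζ => reflection a b * Matrix.diagonal (fun s => if s = b then ζ else 1)) _
      (fun _ => rfl)]
    rw [integral_add_haarSU (by exact ((hf _).add (hf _)).add (hf _)) (hf _),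
      integral_add_haarSU (by exact (hf _).add (hf _)) (hf _), integral_add_haarSU (hf _) (hf _),
      h 1 (by simp), h (-1) (by simp), h Complex.I (by simp), h (-Complex.I) (by simp)]
    ring
  exact mul_left_cancel₀ (by norm_num) key

@[fun_prop]
theorem continuous_conj_vonNeumann_apply {d : ℕ} (V : Matrix (Fin d) (Fin d) ℂ) (i a b : Fin d) :
    Continuous fun U : SU d => (V * vonNeumann U i * Vᴴ) a b := by
  simp only [Matrix.mul_apply]
  fun_prop

/-- Let `s = 9/25` and `t = 16/25`. With `M` the moment of `aaa` and `N` that of `aab`, invariance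
reads `M = (s³ + t³) M + 9 s t (s + t) N`. Since `s + t = 1`, `1 - s³ - t³ = 3 s t`, whence `M = 3
N`. -/
theorem haarMoment_self_diag₂ {d : ℕ} (hd : 0 < d) {i a b : Fin d} (hab : a ≠ b) :
    haarMoment i i i a a a a b b = haarMoment i i i a a a a a a / 3 := by
  have hI : Complex.I ^ 2 = -1 := Complex.I_sq
  have h := four_mul_integral hd hab (fun E => E i a a * E i a a * E i a a)
    (fun V => by fun_prop)
    (fun U => (9 / 25) ^ 3 * (vonNeumann U i a a * vonNeumann U i a a * vonNeumann U i a a) +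
      (16 / 25) ^ 3 * (vonNeumann U i b b * vonNeumann U i b b * vonNeumann U i b b) +
      9 * (9 / 25) ^ 2 * (16 / 25) *
        (vonNeumann U i a a * vonNeumann U i a a * vonNeumann U i b b) +
      9 * (9 / 25) * (16 / 25) ^ 2 *
        (vonNeumann U i b b * vonNeumann U i b b * vonNeumann U i a a))
    (fun V U hV => by
      simp only [hV, reflection_conj_apply hab]
      have := vonNeumann_mul_swap U i a b
      simp only [star_one, star_neg, Complex.star_def, Complex.conj_I]
      generalize vonNeumann U i a b = x at *
      generalize vonNeumann U i b a = y at *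
      generalize vonNeumann U i a a = z at *
      generalize vonNeumann U i b b = w at *
      ring_nf
      simp only [hI, Complex.I_pow_four,
        show Complex.I ^ 6 = -1 by rw [show 6 = 2 * 3 from rfl, pow_mul, hI]; norm_num]
      linear_combination (24 * (9 / 25 * z + 16 / 25 * w) * (144 / 625)) * this)
  rw [integral_add_haarSU (by fun_prop) (by fun_prop), integral_add_haarSU (by fun_prop) (by fun_prop),
    integral_add_haarSU (by fun_prop) (by fun_prop), integral_const_mul, integral_const_mul,
    integral_const_mul, integral_const_mul] at h
  change haarMoment i i i a a a a a a = _ * haarMoment i i i a a a a a a +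
    _ * haarMoment i i i b b b b b b + _ * haarMoment i i i a a a a b b +
    _ * haarMoment i i i b b b b a a at h
  have h1 := haarMoment_row_perm hd (Equiv.swap a b) i i i a a a a a a
  have h2 := haarMoment_row_perm hd (Equiv.swap a b) i i i a a a a b b
  rw [Equiv.swap_apply_left] at h1
  rw [Equiv.swap_apply_left, Equiv.swap_apply_right] at h2
  rw [h1, h2] at h
  -- The constant is `1 / (9 s t)` with `s = 9/25`, `t = 16/25`.
  linear_combination (-(15625 / 32400 : ℂ)) * h

/-- The same argument in degree two, with `c` a spectator row: `1 - s² - t² = 2 s t` against the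
cross term `4 s t`. -/
theorem haarMoment_self_diag₃ {d : ℕ} (hd : 0 < d) {i a b c : Fin d} (hab : a ≠ b) (hca : c ≠ a)
    (hcb : c ≠ b) :
    haarMoment i i i a a b b c c = haarMoment i i i a a a a c c / 2 := by
  have hI : Complex.I ^ 2 = -1 := Complex.I_sq
  have h := four_mul_integral hd hab (fun E => E i a a * E i a a * E i c c)
    (fun V => by fun_prop)
    (fun U => (9 / 25) ^ 2 * (vonNeumann U i a a * vonNeumann U i a a * vonNeumann U i c c) +
      (16 / 25) ^ 2 * (vonNeumann U i b b * vonNeumann U i b b * vonNeumann U i c c) +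
      4 * (9 / 25) * (16 / 25) *
        (vonNeumann U i a a * vonNeumann U i b b * vonNeumann U i c c))
    (fun V U hV => by
      simp only [hV, reflection_conj_apply hab, reflection_conj_apply_of_ne hca hcb]
      have := vonNeumann_mul_swap U i a b
      simp only [star_one, star_neg, Complex.star_def, Complex.conj_I]
      generalize vonNeumann U i a b = x at *
      generalize vonNeumann U i b a = y at *
      generalize vonNeumann U i a a = z at *
      generalize vonNeumann U i b b = w at *
      generalize vonNeumann U i c c = v at *
      ring_nf
      simp only [hI, Complex.I_pow_four]
      linear_combination (8 * v * (144 / 625)) * this)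
  rw [integral_add_haarSU (by fun_prop) (by fun_prop), integral_add_haarSU (by fun_prop) (by fun_prop),
    integral_const_mul, integral_const_mul, integral_const_mul] at h
  change haarMoment i i i a a a a c c = _ * haarMoment i i i a a a a c c +
    _ * haarMoment i i i b b b b c c + _ * haarMoment i i i a a b b c c at h
  have h1 := haarMoment_row_perm hd (Equiv.swap a b) i i i a a a a c c
  rw [Equiv.swap_apply_left, Equiv.swap_apply_of_ne_of_ne hca hcb] at h1
  rw [h1] at h
  linear_combination (-(625 / 576 : ℂ)) * h

/-! ### Moments of a single outcome -/

/-- The Kronecker delta. -/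
def delta {d : ℕ} (a b : Fin d) : ℂ := if a = b then 1 else 0

/-- The sum of the six permutation operators on three systems, entrywise. -/
def permSum {d : ℕ} (a a' b b' c c' : Fin d) : ℂ :=
  delta a a' * delta b b' * delta c c' + delta a b' * delta b a' * delta c c' +
  delta a c' * delta b b' * delta c a' + delta a a' * delta b c' * delta c b' +
  delta a b' * delta b c' * delta c a' + delta a c' * delta b a' * delta c b'

/-- On diagonal index triples `permSum` is `6`, `2` or `1` according as three, two or no indices
agree, in the ratios `1 : 1/3 : 1/6` found for the moments. -/
theorem haarMoment_self_diag {d : ℕ} (hd : 0 < d) (i o a b c : Fin d) :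
    haarMoment i i i a a b b c c = haarMoment i i i o o o o o o / 6 * permSum a a b b c c := by
  have h0 : ∀ a, haarMoment i i i a a a a a a = haarMoment i i i o o o o o o := by
    intro a
    have := haarMoment_row_perm hd (Equiv.swap o a) i i i o o o o o o
    rwa [Equiv.swap_apply_left] at this
  have h1 : ∀ a b, a ≠ b → haarMoment i i i a a a a b b = haarMoment i i i o o o o o o / 3 := by
    intro a b hab
    rw [haarMoment_self_diag₂ hd hab, h0]
  have h2 : ∀ a b, a ≠ b → haarMoment i i i a a b b a a = haarMoment i i i o o o o o o / 3 := by
    intro a b hab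
    rw [haarMoment_self_comm', h1 a b hab]
  have h3 : ∀ a b, a ≠ b → haarMoment i i i b b a a a a = haarMoment i i i o o o o o o / 3 := by
    intro a b hab
    rw [haarMoment_self_comm, h2 a b hab]
  unfold permSum delta
  by_cases hab : a = b
  · subst hab
    by_cases hac : a = c
    · subst hac
      rw [h0]; norm_num
    · rw [h1 a c hac]; simp [hac, Ne.symm hac]; ring
  · by_cases hac : a = c
    · subst hac
      rw [h2 a b hab]; simp [hab, Ne.symm hab]; ring
    · by_cases hbc : b = c
      · subst hbc
        rw [h3 b a (Ne.symm hab)]; simp [hab, Ne.symm hab]; ring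
      · rw [haarMoment_self_diag₃ hd hab (Ne.symm hac) (Ne.symm hbc), h1 a c hac]
        simp [hab, hac, hbc, Ne.symm hab, Ne.symm hac, Ne.symm hbc]; ring

theorem permSum_swap {d : ℕ} (a a' b b' c c' : Fin d) :
    permSum a a' b b' c c' = permSum a b' b a' c c' := by
  unfold permSum; ring

theorem permSum_swap' {d : ℕ} (a a' b b' c c' : Fin d) :
    permSum a a' b b' c c' = permSum a a' b c' c b' := by
  unfold permSum; ring

theorem haarMoment_self_aux {d : ℕ} (hd : 0 < d) (i o a b c a' b' c' : Fin d) :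
    haarMoment i i i a a' b b' c c' = haarMoment i i i o o o o o o / 6 * permSum a a' b b' c c' := by
  have hz : ∀ p, permSum a a' b b' c c' = 0 →
      (if a = p then 1 else 0) + (if b = p then 1 else 0) + (if c = p then 1 else 0) ≠
      (if a' = p then 1 else 0) + (if b' = p then 1 else 0) + (if c' = p then 1 else 0 : ℕ) →
      haarMoment i i i a a' b b' c c' =
        haarMoment i i i o o o o o o / 6 * permSum a a' b b' c c' := fun p h0 h => by
    rw [h0, haarMoment_eq_zero hd _ _ _ _ _ _ _ _ _ p h, mul_zero]
  -- Either the primed indices are a permutation of the unprimed ones, and swaps reduce to the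
  -- diagonal case, or some row occurs unequally often and both sides vanish.
  have key : (a' = a ∧ b' = b ∧ c' = c) ∨ (a' = a ∧ b' = c ∧ c' = b) ∨ (a' = b ∧ b' = a ∧ c' = c) ∨
      (a' = b ∧ b' = c ∧ c' = a) ∨ (a' = c ∧ b' = a ∧ c' = b) ∨ (a' = c ∧ b' = b ∧ c' = a) ∨
      (permSum a a' b b' c c' = 0 ∧ ∃ p,
      (if a = p then 1 else 0) + (if b = p then 1 else 0) + (if c = p then 1 else 0) ≠
      (if a' = p then 1 else 0) + (if b' = p then 1 else 0) + (if c' = p then 1 else 0 : ℕ)) := by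
    by_contra! hcon
    obtain ⟨h1, h2, h3, h4, h5, h6, h7⟩ := hcon
    have hs : permSum a a' b b' c c' = 0 := by
      unfold permSum delta
      grind
    have ha := h7 hs a'
    have hb := h7 hs b'
    have hc := h7 hs c'
    grind
  rcases key with ⟨rfl, rfl, rfl⟩ | ⟨rfl, rfl, rfl⟩ | ⟨rfl, rfl, rfl⟩ | ⟨rfl, rfl, rfl⟩ |
    ⟨rfl, rfl, rfl⟩ | ⟨rfl, rfl, rfl⟩ | ⟨h0, p, hp⟩
  · exact haarMoment_self_diag hd i o _ _ _
  · rw [haarMoment_self_swap', permSum_swap']; exact haarMoment_self_diag hd i o _ _ _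
  · rw [haarMoment_self_swap, permSum_swap]; exact haarMoment_self_diag hd i o _ _ _
  · rw [haarMoment_self_swap', permSum_swap', haarMoment_self_swap, permSum_swap]
    exact haarMoment_self_diag hd i o _ _ _
  · rw [haarMoment_self_swap, permSum_swap, haarMoment_self_swap', permSum_swap']
    exact haarMoment_self_diag hd i o _ _ _
  · rw [haarMoment_self_swap, permSum_swap, haarMoment_self_swap', permSum_swap',
      haarMoment_self_swap, permSum_swap]
    exact haarMoment_self_diag hd i o _ _ _
  · exact hz p h0 hp

theorem integral_finsetSum_haarSU {d : ℕ} {ι : Type} [Fintype ι] {f : ι → SU d → ℂ}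
    (hf : ∀ i, Continuous (f i)) :
    ∫ U, ∑ i, f i U ∂(haarSU d) = ∑ i, ∫ U, f i U ∂(haarSU d) :=
  integral_finsetSum _ fun i _ => integrable_haarSU (hf i)

/-! ### Lower moments and moments of several outcomes -/

/-- The Haar average of a product of two entries of measurement operators. -/
def haarMoment₂ {d : ℕ} (i j a a' b b' : Fin d) : ℂ :=
  ∫ U, vonNeumann U i a a' * vonNeumann U j b b' ∂(haarSU d)

/-- The Haar average of an entry of a measurement operator. -/
def haarMoment₁ {d : ℕ} (i a a' : Fin d) : ℂ := ∫ U, vonNeumann U i a a' ∂(haarSU d)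

theorem sum_vonNeumann_apply {d : ℕ} (U : SU d) (a b : Fin d) :
    ∑ i, vonNeumann U i a b = delta a b := by
  rw [← Matrix.sum_apply, sum_vonNeumann, Matrix.one_apply, delta]

theorem sum_haarMoment_outcome {d : ℕ} (i j a a' b b' c c' : Fin d) :
    ∑ k, haarMoment i j k a a' b b' c c' = delta c c' * haarMoment₂ i j a a' b b' := by
  unfold haarMoment haarMoment₂
  rw [← integral_finsetSum_haarSU (fun i => by fun_prop), ← integral_const_mul]
  simp only [← Finset.mul_sum, sum_vonNeumann_apply]
  congr 1; funext U; ring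

theorem sum_haarMoment₂_outcome {d : ℕ} (i a a' b b' : Fin d) :
    ∑ j, haarMoment₂ i j a a' b b' = delta b b' * haarMoment₁ i a a' := by
  unfold haarMoment₁ haarMoment₂
  rw [← integral_finsetSum_haarSU (fun i => by fun_prop), ← integral_const_mul]
  simp only [← Finset.mul_sum, sum_vonNeumann_apply]
  congr 1; funext U; ring

theorem sum_vonNeumann_diag {d : ℕ} (U : SU d) (i : Fin d) : ∑ a, vonNeumann U i a a = 1 :=
  trace_vonNeumann U i

theorem sum_haarMoment_trace {d : ℕ} (i j k a a' b b' : Fin d) :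
    ∑ c, haarMoment i j k a a' b b' c c = haarMoment₂ i j a a' b b' := by
  unfold haarMoment haarMoment₂
  rw [← integral_finsetSum_haarSU (fun i => by fun_prop)]
  simp only [← Finset.mul_sum, sum_vonNeumann_diag, mul_one]

theorem sum_haarMoment₂_trace {d : ℕ} (i j a a' : Fin d) :
    ∑ b, haarMoment₂ i j a a' b b = haarMoment₁ i a a' := by
  unfold haarMoment₁ haarMoment₂
  rw [← integral_finsetSum_haarSU (fun i => by fun_prop)]
  simp only [← Finset.mul_sum, sum_vonNeumann_diag, mul_one]

theorem sum_haarMoment₁_trace {d : ℕ} (i : Fin d) : ∑ a, haarMoment₁ i a a = 1 := by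
  unfold haarMoment₁
  rw [← integral_finsetSum_haarSU (fun i => by fun_prop)]
  simp [sum_vonNeumann_diag]


theorem sum_delta_mul {d : ℕ} (a : Fin d) (f : Fin d → ℂ) : ∑ c, delta a c * f c = f a := by
  simp [delta]

theorem delta_comm {d : ℕ} (a b : Fin d) : delta a b = delta b a := by
  simp [delta, eq_comm]

theorem delta_self {d : ℕ} (a : Fin d) : delta a a = 1 := by simp [delta]

theorem delta_of_ne {d : ℕ} {a b : Fin d} (h : a ≠ b) : delta a b = 0 := by simp [delta, h]

theorem sum_permSum {d : ℕ} (a a' b b' : Fin d) :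
    ∑ c, permSum a a' b b' c c = ((d : ℂ) + 2) *
      (delta a a' * delta b b' + delta a b' * delta b a') := by
  have h1 : ∀ x y : Fin d, ∀ w, ∑ c, w * delta x c * delta c y = w * delta x y := by
    intro x y w
    rw [← sum_delta_mul x (fun c => delta c y), Finset.mul_sum]
    congr 1; funext c; ring
  have h2 : ∀ w : ℂ, ∑ c : Fin d, w * delta c c = d * w := by
    intro w; simp [delta_self]
  have e1 : ∀ c, permSum a a' b b' c c =
      delta a a' * delta b b' * delta c c + delta a b' * delta b a' * delta c c +
      delta b b' * delta a c * delta c a' + delta a a' * delta b c * delta c b' +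
      delta a b' * delta b c * delta c a' + delta b a' * delta a c * delta c b' := by
    intro c; unfold permSum; ring
  simp only [e1, Finset.sum_add_distrib, h1, h2]
  ring

theorem sum_delta_pair {d : ℕ} (a a' : Fin d) :
    ∑ b, (delta a a' * delta b b + delta a b * delta b a') = ((d : ℂ) + 1) * delta a a' := by
  rw [Finset.sum_add_distrib, sum_delta_mul a (fun c => delta c a')]
  simp [delta_self]
  ring

/-- Taking the trace over the three slots one at a time gives the factors `d + 2`, `d + 1` and `d`;
the total must be `1`. -/
theorem haarMoment_self {d : ℕ} (hd : 0 < d) (i a a' b b' c c' : Fin d) :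
    haarMoment i i i a a' b b' c c' = 1 / (d * (d + 1) * (d + 2)) * permSum a a' b b' c c' := by
  obtain ⟨x, hx⟩ : ∃ x : ℂ, ∀ a a' b b' c c' : Fin d,
      haarMoment i i i a a' b b' c c' = x * permSum a a' b b' c c' :=
    ⟨_, fun a a' b b' c c' => haarMoment_self_aux hd i i a b c a' b' c'⟩
  have h2 : ∀ a a' b b', haarMoment₂ i i a a' b b' =
      x * (((d : ℂ) + 2) * (delta a a' * delta b b' + delta a b' * delta b a')) := by
    intro a a' b b'
    rw [← sum_haarMoment_trace i i i, ← sum_permSum, Finset.mul_sum]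
    simp only [hx]
  have h1 : ∀ a a', haarMoment₁ i a a' = x * (((d : ℂ) + 2) * (((d : ℂ) + 1) * delta a a')) := by
    intro a a'
    rw [← sum_haarMoment₂_trace i i, ← sum_delta_pair, Finset.mul_sum, Finset.mul_sum]
    simp only [h2]
  have h := sum_haarMoment₁_trace i
  simp only [h1, delta_self, Finset.sum_const, Finset.card_univ, Fintype.card_fin, nsmul_eq_mul]
    at h
  have hd1 : (d : ℂ) ≠ 0 := by exact_mod_cast hd.ne'
  have hd2 : (d : ℂ) + 1 ≠ 0 := by exact_mod_cast (d.succ_ne_zero)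
  have hd3 : (d : ℂ) + 2 ≠ 0 := by exact_mod_cast (d + 1).succ_ne_zero
  rw [hx]
  congr 1
  field_simp
  linear_combination h

theorem haarMoment₂_self {d : ℕ} (hd : 0 < d) (i a a' b b' : Fin d) :
    haarMoment₂ i i a a' b b' =
      1 / (d * (d + 1)) * (delta a a' * delta b b' + delta a b' * delta b a') := by
  have hd3 : (d : ℂ) + 2 ≠ 0 := by exact_mod_cast (d + 1).succ_ne_zero
  rw [← sum_haarMoment_trace i i i]
  simp only [haarMoment_self hd, ← Finset.mul_sum, sum_permSum]
  field_simp

theorem haarMoment₁_eq {d : ℕ} (hd : 0 < d) (i a a' : Fin d) :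
    haarMoment₁ i a a' = 1 / d * delta a a' := by
  have hd2 : (d : ℂ) + 1 ≠ 0 := by exact_mod_cast (d.succ_ne_zero)
  rw [← sum_haarMoment₂_trace i i]
  simp only [haarMoment₂_self hd, ← Finset.mul_sum, sum_delta_pair]
  field_simp

/-- By completeness the sum over `j` is a first moment; relabeling shows that the `d - 1` terms with
`j ≠ i` are equal. The mixed third moments follow in the same way. -/
theorem haarMoment₂_of_ne {d : ℕ} (hd : 2 ≤ d) {i j : Fin d} (hij : i ≠ j) (a a' b b' : Fin d) :
    haarMoment₂ i j a a' b b' =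
      1 / ((d - 1) * d * (d + 1)) * (d * (delta a a' * delta b b') - delta a b' * delta b a') := by
  have hd' : 0 < d := by omega
  have h1 : ∀ l ∈ Finset.univ.erase i, haarMoment₂ i l a a' b b' = haarMoment₂ i j a a' b b' := by
    intro l hl
    have hl : l ≠ i := Finset.ne_of_mem_erase hl
    have := integral_perm_vonNeumann hd' (Equiv.swap j l) (fun E => E i a a' * E j b b')
    beta_reduce at this
    rw [Equiv.swap_apply_left, Equiv.swap_apply_of_ne_of_ne hij hl.symm] at this
    exact this
  have h := sum_haarMoment₂_outcome i a a' b b'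
  rw [← Finset.add_sum_erase _ _ (Finset.mem_univ i), Finset.sum_congr rfl h1, Finset.sum_const,
    Finset.card_erase_of_mem (Finset.mem_univ i), Finset.card_univ, Fintype.card_fin,
    haarMoment₂_self hd', haarMoment₁_eq hd', nsmul_eq_mul, Nat.cast_sub (by omega)] at h
  have hd1 : (d : ℂ) ≠ 0 := by exact_mod_cast hd'.ne'
  have hd2 : (d : ℂ) + 1 ≠ 0 := by exact_mod_cast (d.succ_ne_zero)
  have hd3 : (d : ℂ) - 1 ≠ 0 := by
    rw [sub_ne_zero]; exact_mod_cast (show d ≠ 1 by omega)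
  field_simp at h ⊢
  push_cast at h
  linear_combination h

theorem haarMoment_iik {d : ℕ} (hd : 2 ≤ d) {i k : Fin d} (hik : i ≠ k) (a a' b b' c c' : Fin d) :
    haarMoment i i k a a' b b' c c' = 1 / ((d - 1) * d * (d + 1) * (d + 2)) *
      ((d + 2) * (delta a a' * delta b b' * delta c c' + delta a b' * delta b a' * delta c c') -
        permSum a a' b b' c c') := by
  have hd' : 0 < d := by omega
  have h1 : ∀ l ∈ Finset.univ.erase i,
      haarMoment i i l a a' b b' c c' = haarMoment i i k a a' b b' c c' := by
    intro l hl
    have hl : l ≠ i := Finset.ne_of_mem_erase hl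
    have := haarMoment_col_perm hd' (Equiv.swap k l) i i k a a' b b' c c'
    rwa [Equiv.swap_apply_left, Equiv.swap_apply_of_ne_of_ne hik hl.symm] at this
  have h := sum_haarMoment_outcome i i a a' b b' c c'
  rw [← Finset.add_sum_erase _ _ (Finset.mem_univ i), Finset.sum_congr rfl h1, Finset.sum_const,
    Finset.card_erase_of_mem (Finset.mem_univ i), Finset.card_univ, Fintype.card_fin,
    haarMoment₂_self hd', haarMoment_self hd', nsmul_eq_mul, Nat.cast_sub (by omega)] at h
  have hd1 : (d : ℂ) ≠ 0 := by exact_mod_cast hd'.ne'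
  have hd2 : (d : ℂ) + 1 ≠ 0 := by exact_mod_cast (d.succ_ne_zero)
  have hd4 : (d : ℂ) + 2 ≠ 0 := by exact_mod_cast (d + 1).succ_ne_zero
  have hd3 : (d : ℂ) - 1 ≠ 0 := by
    rw [sub_ne_zero]; exact_mod_cast (show d ≠ 1 by omega)
  field_simp at h ⊢
  push_cast at h
  linear_combination h

theorem haarMoment_iki {d : ℕ} (i k a a' b b' c c' : Fin d) :
    haarMoment i k i a a' b b' c c' = haarMoment i i k a a' c c' b b' := by
  unfold haarMoment; congr 1; funext U; ring

theorem haarMoment_kii {d : ℕ} (i k a a' b b' c c' : Fin d) :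
    haarMoment k i i a a' b b' c c' = haarMoment i i k b b' c c' a a' := by
  unfold haarMoment; congr 1; funext U; ring

theorem haarMoment_ijk {d : ℕ} (hd : 3 ≤ d) {i j k : Fin d} (hij : i ≠ j) (hik : i ≠ k)
    (hjk : j ≠ k) (a a' b b' c c' : Fin d) :
    (d - 2) * haarMoment i j k a a' b b' c c' = delta c c' * haarMoment₂ i j a a' b b' -
      haarMoment i j i a a' b b' c c' - haarMoment i j j a a' b b' c c' := by
  have hd' : 0 < d := by omega
  have h1 : ∀ l ∈ (Finset.univ.erase i).erase j,
      haarMoment i j l a a' b b' c c' = haarMoment i j k a a' b b' c c' := by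
    intro l hl
    have hl1 : l ≠ j := Finset.ne_of_mem_erase hl
    have hl2 : l ≠ i := Finset.ne_of_mem_erase (Finset.mem_of_mem_erase hl)
    have := haarMoment_col_perm hd' (Equiv.swap k l) i j k a a' b b' c c'
    rwa [Equiv.swap_apply_left, Equiv.swap_apply_of_ne_of_ne hik hl2.symm,
      Equiv.swap_apply_of_ne_of_ne hjk hl1.symm] at this
  have h := sum_haarMoment_outcome i j a a' b b' c c'
  have hj : j ∈ Finset.univ.erase i := Finset.mem_erase.2 ⟨hij.symm, Finset.mem_univ j⟩
  rw [← Finset.add_sum_erase _ _ (Finset.mem_univ i), ← Finset.add_sum_erase _ _ hj,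
    Finset.sum_congr rfl h1, Finset.sum_const, Finset.card_erase_of_mem hj,
    Finset.card_erase_of_mem (Finset.mem_univ i), Finset.card_univ, Fintype.card_fin, nsmul_eq_mul,
    Nat.cast_sub (by omega), Nat.cast_sub (by omega)] at h
  push_cast at h
  linear_combination h

/-! ### The vectors `Ψ^±_m` and the algebra `M₂ ⊕ ℂ ⊕ ℂ` -/

/-- The norm `√(2 (d ± 1))` of the vectors `|ω⟩_{AC} |m⟩_B ± |m⟩_A |ω⟩_{BC}`. -/
def psiNorm (d : ℕ) (s : Fin 2) : ℂ := ((√(2 * ((d : ℝ) + (-1) ^ (s : ℕ))) : ℝ) : ℂ)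

theorem psiNorm_mul_self {d : ℕ} (hd : 2 ≤ d) (s : Fin 2) :
    psiNorm d s * psiNorm d s = 2 * (d + (-1) ^ (s : ℕ)) := by
  have hd' : (2 : ℝ) ≤ d := by exact_mod_cast hd
  have : (0 : ℝ) ≤ 2 * ((d : ℝ) + (-1) ^ (s : ℕ)) := by
    fin_cases s <;> norm_num <;> linarith
  rw [psiNorm, ← Complex.ofReal_mul, Real.mul_self_sqrt this]
  push_cast; rfl

theorem psiNorm_ne_zero {d : ℕ} (hd : 2 ≤ d) (s : Fin 2) : psiNorm d s ≠ 0 := by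
  have hd' : (2 : ℝ) ≤ d := by exact_mod_cast hd
  have : (0 : ℝ) < 2 * ((d : ℝ) + (-1) ^ (s : ℕ)) := by
    fin_cases s <;> norm_num <;> linarith
  rw [psiNorm, Complex.ofReal_ne_zero]
  exact (Real.sqrt_pos.2 this).ne'

theorem psi_apply (d : ℕ) (s : Fin 2) (m a b c : Fin d) :
    psi d s m ((a, b), c) =
      (delta a c * delta b m + (-1) ^ (s : ℕ) * (delta a m * delta b c)) / psiNorm d s := by
  have h : ∀ p q : Prop, [Decidable p] → [Decidable q] →
      (if p ∧ q then 1 else 0 : ℂ) = (if p then 1 else 0) * (if q then 1 else 0) := by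
    intro p q _ _; split_ifs <;> simp_all
  simp only [psi, delta, psiNorm, h]

theorem star_psi (d : ℕ) (s : Fin 2) (m : Fin d) : star (psi d s m) = psi d s m := by
  ext ⟨⟨a, b⟩, c⟩
  have h : ∀ x y : Fin d, star (delta x y) = delta x y := by
    intro x y; unfold delta; split_ifs <;> simp
  have h2 : star (psiNorm d s) = psiNorm d s := Complex.conj_ofReal _
  rw [Pi.star_apply, psi_apply, star_div₀, h2, star_add, star_mul', star_mul', star_mul', h, h, h, h,
    star_pow, star_neg, star_one]

theorem sum_delta_mul' {d : ℕ} (a : Fin d) (f : Fin d → ℂ) : ∑ c, delta c a * f c = f a := by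
  simp [delta]

/-- Each summand `|ω⟩|m⟩` has squared norm `d` and the two summands overlap in `1`, whence `2 (d ±
1)`; for opposite signs the contributions cancel. -/
theorem psi_dotProduct {d : ℕ} (hd : 2 ≤ d) (s t : Fin 2) (m n : Fin d) :
    psi d s m ⬝ᵥ psi d t n = if s = t ∧ m = n then 1 else 0 := by
  have key : psi d s m ⬝ᵥ psi d t n =
      (delta m n * (d * (1 + (-1) ^ (s : ℕ) * (-1) ^ (t : ℕ)) + (-1) ^ (s : ℕ) + (-1) ^ (t : ℕ))) /
        (psiNorm d s * psiNorm d t) := by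
    simp only [dotProduct, Fintype.sum_prod_type, psi_apply, div_mul_div_comm, ← Finset.sum_div]
    congr 1
    have e : ∀ a b c : Fin d, (delta a c * delta b m + (-1) ^ (s : ℕ) * (delta a m * delta b c)) *
        (delta a c * delta b n + (-1) ^ (t : ℕ) * (delta a n * delta b c)) =
        delta a c * (delta b m * delta b n) +
        delta a c * (delta b c * ((-1) ^ (t : ℕ) * (delta b m * delta a n))) +
        delta a c * (delta b c * ((-1) ^ (s : ℕ) * (delta a m * delta b n))) +
        delta b c * ((-1) ^ (s : ℕ) * (-1) ^ (t : ℕ) * (delta a m * delta a n)) := by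
      intro a b c
      have h : ∀ x y : Fin d, delta x y * delta x y = delta x y := by
        intro x y; unfold delta; split_ifs <;> simp
      linear_combination (delta b m * delta b n) * h a c + (-1) ^ (s : ℕ) * (-1) ^ (t : ℕ) *
        (delta a m * delta a n) * h b c
    simp only [e, Finset.sum_add_distrib, sum_delta_mul, sum_delta_mul', Finset.sum_const,
      Finset.card_univ, Fintype.card_fin, nsmul_eq_mul, ← Finset.mul_sum]
    ring
  rw [key]
  have h0 := psiNorm_mul_self hd
  have h1 := psiNorm_ne_zero hd
  rw [div_eq_iff (mul_ne_zero (h1 s) (h1 t))]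
  by_cases hst : s = t
  · subst hst
    rw [h0]
    by_cases hmn : m = n
    · simp [hmn, delta_self]
      fin_cases s <;> norm_num <;> ring
    · simp [hmn, delta_of_ne]
  · rw [if_neg (by tauto), zero_mul]
    have : (-1 : ℂ) ^ (s : ℕ) = - (-1) ^ (t : ℕ) := by
      fin_cases s <;> fin_cases t <;> simp_all
    rw [this]
    fin_cases t <;> simp

/-- The matrix units `∑ m, |Ψ^a_m⟩⟨Ψ^b_m|`. -/
def psiUnit (d : ℕ) (a b : Fin 2) : Matrix (Pair d × Fin d) (Pair d × Fin d) ℂ :=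
  ∑ m, Matrix.vecMulVec (psi d a m) (star (psi d b m))

theorem alphaBlock_eq (d : ℕ) (r : Matrix (Fin 2) (Fin 2) ℂ) :
    alphaBlock d r = ∑ a, ∑ b, r a b • psiUnit d a b := rfl

theorem psiUnit_mul {d : ℕ} (hd : 2 ≤ d) (a b a' b' : Fin 2) :
    psiUnit d a b * psiUnit d a' b' = if b = a' then psiUnit d a b' else 0 := by
  unfold psiUnit
  simp only [Matrix.sum_mul, Matrix.mul_sum, Matrix.vecMulVec_mul_vecMulVec, star_psi,
    psi_dotProduct hd]
  by_cases h : b = a' <;> simp [h, ite_smul, apply_ite]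

theorem conjTranspose_psiUnit (d : ℕ) (a b : Fin 2) : (psiUnit d a b)ᴴ = psiUnit d b a := by
  unfold psiUnit
  simp [Matrix.conjTranspose_sum, Matrix.conjTranspose_vecMulVec]

theorem alphaBlock_mul {d : ℕ} (hd : 2 ≤ d) (r s : Matrix (Fin 2) (Fin 2) ℂ) :
    alphaBlock d r * alphaBlock d s = alphaBlock d (r * s) := by
  simp only [alphaBlock_eq, Fin.sum_univ_two, add_mul, mul_add, smul_mul_smul_comm,
    psiUnit_mul hd, Matrix.mul_apply, add_smul]
  simp
  abel

theorem conjTranspose_alphaBlock (d : ℕ) (r : Matrix (Fin 2) (Fin 2) ℂ) :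
    (alphaBlock d r)ᴴ = alphaBlock d rᴴ := by
  simp only [alphaBlock_eq, Fin.sum_univ_two, Matrix.conjTranspose_add,
    Matrix.conjTranspose_smul, conjTranspose_psiUnit, Matrix.conjTranspose_apply]
  abel

theorem alphaBlock_add (d : ℕ) (r s : Matrix (Fin 2) (Fin 2) ℂ) :
    alphaBlock d (r + s) = alphaBlock d r + alphaBlock d s := by
  simp only [alphaBlock_eq, Matrix.add_apply, add_smul, Finset.sum_add_distrib]

theorem alphaBlock_smul (d : ℕ) (k : ℂ) (r : Matrix (Fin 2) (Fin 2) ℂ) :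
    alphaBlock d (k • r) = k • alphaBlock d r := by
  simp only [alphaBlock_eq, Matrix.smul_apply, smul_assoc, Finset.smul_sum]

theorem projPM_apply (d : ℕ) (s : Fin 2) (a b a' b' : Fin d) :
    projPM d s (a, b) (a', b') =
      (delta a a' * delta b b' + (-1) ^ (s : ℕ) * (delta a b' * delta b a')) / 2 := by
  have h : ∀ p q : Prop, [Decidable p] → [Decidable q] →
      (if p ∧ q then 1 else 0 : ℂ) = (if p then 1 else 0) * (if q then 1 else 0) := by
    intro p q _ _; split_ifs <;> simp_all
  simp only [projPM, Matrix.smul_apply, Matrix.add_apply, Matrix.one_apply, Matrix.of_apply,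
    Prod.swap_prod_mk, Prod.mk.injEq, delta, h, smul_eq_mul]
  ring

theorem projPM_kronecker_mulVec_psi (d : ℕ) (s t : Fin 2) (m : Fin d) :
    (projPM d s ⊗ₖ (1 : Matrix (Fin d) (Fin d) ℂ)) *ᵥ psi d t m = if s = t then psi d t m else 0 := by
  have key : ∀ a b c : Fin d, ((projPM d s ⊗ₖ (1 : Matrix (Fin d) (Fin d) ℂ)) *ᵥ psi d t m) ((a, b), c) =
      (psi d t m ((a, b), c) + (-1) ^ (s : ℕ) * psi d t m ((b, a), c)) / 2 := by
    intro a b c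
    simp only [Matrix.mulVec, dotProduct, Fintype.sum_prod_type, Matrix.kroneckerMap_apply,
      projPM_apply]
    have e : ∀ x y z : Fin d, (delta a x * delta b y + (-1) ^ (s : ℕ) * (delta a y * delta b x)) / 2 *
        (1 : Matrix (Fin d) (Fin d) ℂ) c z * psi d t m ((x, y), z) =
        delta c z * (delta b y * (delta a x * (psi d t m ((x, y), z) / 2))) +
        delta c z * (delta a y * (delta b x * ((-1) ^ (s : ℕ) * psi d t m ((x, y), z) / 2))) := by
      intro x y z
      rw [Matrix.one_apply]
      change _ * delta c z * _ = _
      ring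
    simp only [e, Finset.sum_add_distrib, sum_delta_mul]
    ring
  ext ⟨⟨a, b⟩, c⟩
  rw [key]
  have : psi d t m ((b, a), c) = (-1) ^ (t : ℕ) * psi d t m ((a, b), c) := by
    rw [psi_apply, psi_apply]
    fin_cases t <;> simp <;> ring
  rw [this]
  fin_cases s <;> fin_cases t <;> simp

theorem projPM_isHermitian (d : ℕ) (s : Fin 2) : (projPM d s)ᴴ = projPM d s := by
  ext ⟨a, b⟩ ⟨a', b'⟩
  rw [Matrix.conjTranspose_apply, projPM_apply, projPM_apply]
  have h : ∀ x y : Fin d, star (delta x y) = delta x y := by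
    intro x y; unfold delta; split_ifs <;> simp
  simp only [star_div₀, star_add, star_mul', star_pow, star_neg, star_one, h]
  rw [delta_comm a' a, delta_comm b' b, delta_comm a' b, delta_comm b' a]
  simp
  ring

theorem projPM_mul (d : ℕ) (s t : Fin 2) :
    projPM d s * projPM d t = if s = t then projPM d s else 0 := by
  ext ⟨a, b⟩ ⟨a', b'⟩
  rw [Matrix.mul_apply, Fintype.sum_prod_type]
  simp only [projPM_apply]
  have e : ∀ x y : Fin d, (delta a x * delta b y + (-1) ^ (s : ℕ) * (delta a y * delta b x)) / 2 *
        ((delta x a' * delta y b' + (-1) ^ (t : ℕ) * (delta x b' * delta y a')) / 2) =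
        delta b y * (delta a x *
          ((delta x a' * delta y b' + (-1) ^ (t : ℕ) * (delta x b' * delta y a')) / 4)) +
        delta a y * (delta b x * ((-1) ^ (s : ℕ) *
          ((delta x a' * delta y b' + (-1) ^ (t : ℕ) * (delta x b' * delta y a')) / 4))) := by
    intro x y; ring
  simp only [e, Finset.sum_add_distrib, sum_delta_mul]
  fin_cases s <;> fin_cases t <;> simp [projPM_apply] <;> ring

theorem projPM_add (d : ℕ) : projPM d 0 + projPM d 1 = 1 := by
  ext ⟨a, b⟩ ⟨a', b'⟩
  rw [Matrix.add_apply, projPM_apply, projPM_apply, Matrix.one_apply]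
  simp only [Prod.mk.injEq, delta]
  split_ifs <;> simp_all <;> norm_num

section
open scoped MatrixOrder

theorem exists_eq_conjTranspose_mul_self {n : Type} [Fintype n] [DecidableEq n] {A : Matrix n n ℂ}
    (hA : A.PosSemidef) : ∃ B : Matrix n n ℂ, A = Bᴴ * B :=
  CStarAlgebra.nonneg_iff_eq_star_mul_self.mp hA.nonneg

end

/-- The trace of a product of two positive operators is nonnegative. -/
theorem re_trace_mul_nonneg {n : Type} [Fintype n] [DecidableEq n] {A B : Matrix n n ℂ}
    (hA : A.PosSemidef) (hB : B.PosSemidef) : 0 ≤ (A * B).trace.re := by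
  obtain ⟨C, rfl⟩ := exists_eq_conjTranspose_mul_self hA
  rw [Matrix.mul_assoc, Matrix.trace_mul_comm]
  exact (Complex.nonneg_iff.1 (hB.mul_mul_conjTranspose_same C).trace_nonneg).1

/-- The operators `P^± ⊗ I_C`. -/
def projABC (d : ℕ) (s : Fin 2) : Matrix (Pair d × Fin d) (Pair d × Fin d) ℂ :=
  projPM d s ⊗ₖ (1 : Matrix (Fin d) (Fin d) ℂ)

theorem conjTranspose_projABC (d : ℕ) (s : Fin 2) : (projABC d s)ᴴ = projABC d s := by
  rw [projABC, Matrix.conjTranspose_kronecker, projPM_isHermitian, Matrix.conjTranspose_one]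

theorem projABC_mul (d : ℕ) (s t : Fin 2) :
    projABC d s * projABC d t = if s = t then projABC d s else 0 := by
  rw [projABC, projABC, ← Matrix.mul_kronecker_mul, projPM_mul, mul_one]
  split_ifs <;> simp

theorem projABC_add (d : ℕ) : projABC d 0 + projABC d 1 = 1 := by
  rw [projABC, projABC, ← Matrix.add_kronecker, projPM_add, Matrix.one_kronecker_one]

theorem projABC_mul_psiUnit (d : ℕ) (s a b : Fin 2) :
    projABC d s * psiUnit d a b = if s = a then psiUnit d a b else 0 := by
  unfold psiUnit projABC
  simp only [Matrix.mul_sum, Matrix.mul_vecMulVec, projPM_kronecker_mulVec_psi]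
  split_ifs <;> simp

theorem projABC_mul_alphaBlock (d : ℕ) (s : Fin 2) (r : Matrix (Fin 2) (Fin 2) ℂ) :
    projABC d s * alphaBlock d r = alphaBlock d (Matrix.single s s 1 * r) := by
  simp only [alphaBlock_eq, Fin.sum_univ_two, mul_add, Matrix.mul_smul, projABC_mul_psiUnit]
  fin_cases s <;> simp [Matrix.single_mul_apply_same, Matrix.single_mul_apply_of_ne]

theorem alphaBlock_mul_projABC (d : ℕ) (s : Fin 2) (r : Matrix (Fin 2) (Fin 2) ℂ) :
    alphaBlock d r * projABC d s = alphaBlock d (r * Matrix.single s s 1) := by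
  have h := congrArg Matrix.conjTranspose (projABC_mul_alphaBlock d s rᴴ)
  simpa [conjTranspose_projABC, conjTranspose_alphaBlock, Matrix.conjTranspose_mul] using h

theorem projBeta_eq (d : ℕ) : projBeta d = projABC d 0 - alphaBlock d (Matrix.single 0 0 1) := by
  rw [projBeta, projABC]
  congr 2
  ext i j; fin_cases i <;> fin_cases j <;> simp

theorem projGamma_eq (d : ℕ) : projGamma d = projABC d 1 - alphaBlock d (Matrix.single 1 1 1) := by
  rw [projGamma, projABC]
  congr 2
  ext i j; fin_cases i <;> fin_cases j <;> simp

/-- The operator `P^α ⊗ r + x P^β + y P^γ`. -/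
def block (d : ℕ) (r : Matrix (Fin 2) (Fin 2) ℂ) (x y : ℂ) :
    Matrix (Pair d × Fin d) (Pair d × Fin d) ℂ :=
  alphaBlock d r + x • projBeta d + y • projGamma d

theorem block_add (d : ℕ) (r r' : Matrix (Fin 2) (Fin 2) ℂ) (x x' y y' : ℂ) :
    block d r x y + block d r' x' y' = block d (r + r') (x + x') (y + y') := by
  simp only [block, alphaBlock_add, add_smul]; abel

theorem block_smul (d : ℕ) (k : ℂ) (r : Matrix (Fin 2) (Fin 2) ℂ) (x y : ℂ) :
    k • block d r x y = block d (k • r) (k * x) (k * y) := by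
  simp only [block, alphaBlock_smul, smul_add, smul_smul]

theorem block_sub (d : ℕ) (r r' : Matrix (Fin 2) (Fin 2) ℂ) (x x' y y' : ℂ) :
    block d r x y - block d r' x' y' = block d (r - r') (x - x') (y - y') := by
  rw [sub_eq_add_neg, ← neg_one_smul ℂ, block_smul, block_add]
  simp [sub_eq_add_neg]

theorem block_zero (d : ℕ) : block d 0 0 0 = 0 := by
  simp [block, alphaBlock]

theorem alphaBlock_zero (d : ℕ) : alphaBlock d 0 = 0 := by simp [alphaBlock]

theorem single_add_single : (Matrix.single 0 0 1 + Matrix.single 1 1 1 : Matrix (Fin 2) (Fin 2) ℂ) = 1 := by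
  ext i j; fin_cases i <;> fin_cases j <;> simp

theorem block_one (d : ℕ) : block d 1 1 1 = 1 := by
  rw [block, projBeta_eq, projGamma_eq, ← single_add_single, alphaBlock_add, ← projABC_add d]
  simp only [one_smul]
  abel

/-- The units `∑ |Ψ^a_m⟩⟨Ψ^b_m|` multiply like matrix units and `P^± ⊗ I` acts on them as `|±⟩⟨±|`,
so `P^β` and `P^γ` are orthogonal to the `α` part and to each other. -/
theorem block_mul {d : ℕ} (hd : 2 ≤ d) (r r' : Matrix (Fin 2) (Fin 2) ℂ) (x x' y y' : ℂ) :
    block d r x y * block d r' x' y' = block d (r * r') (x * x') (y * y') := by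
  have bα : ∀ s, projBeta d * alphaBlock d s = 0 := by
    intro s; rw [projBeta_eq, sub_mul, projABC_mul_alphaBlock, alphaBlock_mul hd, sub_self]
  have cα : ∀ s, projGamma d * alphaBlock d s = 0 := by
    intro s; rw [projGamma_eq, sub_mul, projABC_mul_alphaBlock, alphaBlock_mul hd, sub_self]
  have αb : ∀ s, alphaBlock d s * projBeta d = 0 := by
    intro s; rw [projBeta_eq, mul_sub, alphaBlock_mul_projABC, alphaBlock_mul hd, sub_self]
  have αc : ∀ s, alphaBlock d s * projGamma d = 0 := by
    intro s; rw [projGamma_eq, mul_sub, alphaBlock_mul_projABC, alphaBlock_mul hd, sub_self]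
  have bb : projBeta d * projBeta d = projBeta d := by
    nth_rw 2 [projBeta_eq]
    rw [mul_sub, bα, sub_zero, projBeta_eq, sub_mul, projABC_mul, alphaBlock_mul_projABC]
    simp
  have cc : projGamma d * projGamma d = projGamma d := by
    nth_rw 2 [projGamma_eq]
    rw [mul_sub, cα, sub_zero, projGamma_eq, sub_mul, projABC_mul, alphaBlock_mul_projABC]
    simp
  have bc : projBeta d * projGamma d = 0 := by
    rw [projGamma_eq, mul_sub, bα, sub_zero, projBeta_eq, sub_mul, projABC_mul,
      alphaBlock_mul_projABC]
    simp [alphaBlock_zero]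
  have cb : projGamma d * projBeta d = 0 := by
    rw [projBeta_eq, mul_sub, cα, sub_zero, projGamma_eq, sub_mul, projABC_mul,
      alphaBlock_mul_projABC]
    simp [alphaBlock_zero]
  simp only [block, add_mul, mul_add, smul_mul_smul_comm, Matrix.smul_mul, Matrix.mul_smul,
    alphaBlock_mul hd, bα, cα, αb, αc, bb, cc, bc, cb, smul_zero, add_zero, zero_add]

theorem conjTranspose_block (d : ℕ) (r : Matrix (Fin 2) (Fin 2) ℂ) (x y : ℂ) :
    (block d r x y)ᴴ = block d rᴴ (star x) (star y) := by
  simp only [block, projBeta_eq, projGamma_eq, Matrix.conjTranspose_add, Matrix.conjTranspose_smul,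
    Matrix.conjTranspose_sub, conjTranspose_alphaBlock, conjTranspose_projABC,
    Matrix.conjTranspose_single, star_one]

/-- A factorization `r = t† t` and square roots of the scalars lift through the `*`-homomorphism
`block`. -/
theorem block_posSemidef {d : ℕ} (hd : 2 ≤ d) {r : Matrix (Fin 2) (Fin 2) ℂ} (hr : r.PosSemidef)
    {x y : ℝ} (hx : 0 ≤ x) (hy : 0 ≤ y) : (block d r x y).PosSemidef := by
  obtain ⟨t, rfl⟩ := exists_eq_conjTranspose_mul_self hr
  have h : ∀ x : ℝ, 0 ≤ x → (x : ℂ) = star ((√x : ℝ) : ℂ) * ((√x : ℝ) : ℂ) := by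
    intro x hx
    rw [Complex.star_def, Complex.conj_ofReal, ← Complex.ofReal_mul, Real.mul_self_sqrt hx]
  rw [h x hx, h y hy, ← block_mul hd, ← conjTranspose_block]
  exact Matrix.posSemidef_conjTranspose_mul_self _

theorem psiUnit_apply (d : ℕ) (s t : Fin 2) (a b c a' b' c' : Fin d) :
    psiUnit d s t ((a, b), c) ((a', b'), c') =
      (delta a c * delta a' c' * delta b b' + (-1) ^ (t : ℕ) * (delta a c * delta b a' * delta b' c') +
        (-1) ^ (s : ℕ) * (delta b c * delta a' c' * delta a b') +
        (-1) ^ (s : ℕ) * (-1) ^ (t : ℕ) * (delta b c * delta b' c' * delta a a')) /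
          (psiNorm d s * psiNorm d t) := by
  rw [psiUnit, Matrix.sum_apply]
  simp only [Matrix.vecMulVec_apply, star_psi, psi_apply, div_mul_div_comm, ← Finset.sum_div]
  congr 1
  have e : ∀ m : Fin d, (delta a c * delta b m + (-1) ^ (s : ℕ) * (delta a m * delta b c)) *
      (delta a' c' * delta b' m + (-1) ^ (t : ℕ) * (delta a' m * delta b' c')) =
      delta b m * (delta a c * delta a' c' * delta b' m) +
      delta b m * ((-1) ^ (t : ℕ) * (delta a c * delta b' c') * delta a' m) +
      delta a m * ((-1) ^ (s : ℕ) * (delta b c * delta a' c') * delta b' m) +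
      delta a m * ((-1) ^ (s : ℕ) * (-1) ^ (t : ℕ) * (delta b c * delta b' c') * delta a' m) := by
    intro m; ring
  simp only [e, Finset.sum_add_distrib, sum_delta_mul]
  rw [delta_comm b' b, delta_comm a' b, delta_comm b' a, delta_comm a' a]
  ring

theorem projABC_apply (d : ℕ) (s : Fin 2) (a b c a' b' c' : Fin d) :
    projABC d s ((a, b), c) ((a', b'), c') =
      (delta a a' * delta b b' + (-1) ^ (s : ℕ) * (delta a b' * delta b a')) / 2 * delta c c' := by
  rw [projABC, Matrix.kroneckerMap_apply, projPM_apply, Matrix.one_apply, delta]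
  rfl

/-- The six delta products are the permutation operators on three systems, partially transposed on
`C`. In this basis the Haar moments, which are combinations of permutations, can be compared with
blocks coefficient by coefficient. -/
theorem block_apply {d : ℕ} (hd : 2 ≤ d) (r : Matrix (Fin 2) (Fin 2) ℂ) (x y : ℂ)
    (a b c a' b' c' : Fin d) :
    block d r x y ((a, b), c) ((a', b'), c') =
      ((x + y) / 2) * (delta a a' * delta b b' * delta c c') +
      ((x - y) / 2) * (delta a b' * delta b a' * delta c c') +
      ((r 0 0 - x) / (2 * (d + 1)) + (r 0 1 + r 1 0) / (psiNorm d 0 * psiNorm d 1) +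
        (r 1 1 - y) / (2 * (d - 1))) * (delta a c * delta a' c' * delta b b') +
      ((r 0 0 - x) / (2 * (d + 1)) - (r 0 1 + r 1 0) / (psiNorm d 0 * psiNorm d 1) +
        (r 1 1 - y) / (2 * (d - 1))) * (delta b c * delta b' c' * delta a a') +
      ((r 0 0 - x) / (2 * (d + 1)) - (r 0 1 - r 1 0) / (psiNorm d 0 * psiNorm d 1) -
        (r 1 1 - y) / (2 * (d - 1))) * (delta a c * delta b a' * delta b' c') +
      ((r 0 0 - x) / (2 * (d + 1)) + (r 0 1 - r 1 0) / (psiNorm d 0 * psiNorm d 1) -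
        (r 1 1 - y) / (2 * (d - 1))) * (delta b c * delta a' c' * delta a b') := by
  have h0 : (2 * ((d : ℂ) + 1)) = psiNorm d 0 * psiNorm d 0 := by
    rw [psiNorm_mul_self hd]; simp
  have h1 : (2 * ((d : ℂ) - 1)) = psiNorm d 1 * psiNorm d 1 := by
    rw [psiNorm_mul_self hd]; simp [sub_eq_add_neg]
  have n0 := psiNorm_ne_zero hd 0
  have n1 := psiNorm_ne_zero hd 1
  rw [block, projBeta_eq, projGamma_eq]
  simp only [alphaBlock_eq, Fin.sum_univ_two, Matrix.add_apply, Matrix.smul_apply, Matrix.sub_apply,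
    projABC_apply, psiUnit_apply, smul_eq_mul, h0, h1]
  simp
  field_simp
  ring

/-! ### Block form of the Haar averages -/

/-- The Haar average of `(E_i)ᵀ ⊗ (E_j)ᵀ ⊗ E_k`. -/
def haarOperator {d : ℕ} (i j k : Fin d) : Matrix (Pair d × Fin d) (Pair d × Fin d) ℂ :=
  Matrix.of fun x y => haarMoment i j k y.1.1 x.1.1 y.1.2 x.1.2 x.2 y.2

/-- The rank one matrix `|v⟩⟨v|` for `v = (x √(2(d+1)), y √(2(d-1)))`. -/
def rankOne (d : ℕ) (x y : ℝ) : Matrix (Fin 2) (Fin 2) ℂ :=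
  !![x * x * (2 * (d + 1)), x * y * (psiNorm d 0 * psiNorm d 1);
    x * y * (psiNorm d 0 * psiNorm d 1), y * y * (2 * (d - 1))]

/-- The rank one matrix `|w⟩⟨w|` for `w = (x √(2(d-1)), y √(2(d+1)))`. -/
def rankOne' (d : ℕ) (x y : ℝ) : Matrix (Fin 2) (Fin 2) ℂ :=
  !![x * x * (2 * (d - 1)), x * y * (psiNorm d 0 * psiNorm d 1);
    x * y * (psiNorm d 0 * psiNorm d 1), y * y * (2 * (d + 1))]

theorem psiNorm_zero_mul_self {d : ℕ} (hd : 2 ≤ d) :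
    psiNorm d 0 * psiNorm d 0 = 2 * ((d : ℂ) + 1) := by
  rw [psiNorm_mul_self hd]; simp

theorem psiNorm_one_mul_self {d : ℕ} (hd : 2 ≤ d) :
    psiNorm d 1 * psiNorm d 1 = 2 * ((d : ℂ) - 1) := by
  rw [psiNorm_mul_self hd]; simp [sub_eq_add_neg]

theorem star_psiNorm (d : ℕ) (s : Fin 2) : star (psiNorm d s) = psiNorm d s :=
  Complex.conj_ofReal _

theorem rankOne_posSemidef {d : ℕ} (hd : 2 ≤ d) (x y : ℝ) : (rankOne d x y).PosSemidef := by
  have h : rankOne d x y = Matrix.vecMulVec ![x * psiNorm d 0, y * psiNorm d 1]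
      (star ![x * psiNorm d 0, y * psiNorm d 1]) := by
    have h0 := psiNorm_zero_mul_self hd
    have h1 := psiNorm_one_mul_self hd
    have s0 := star_psiNorm d 0
    have s1 := star_psiNorm d 1
    rw [Complex.star_def] at s0 s1
    ext i j
    fin_cases i <;> fin_cases j <;> simp [rankOne, Matrix.vecMulVec_apply, s0, s1]
    · linear_combination (-(x * x : ℂ)) * h0
    · ring
    · ring
    · linear_combination (-(y * y : ℂ)) * h1
  rw [h]
  exact Matrix.posSemidef_vecMulVec_self_star _

theorem rankOne'_posSemidef {d : ℕ} (hd : 2 ≤ d) (x y : ℝ) : (rankOne' d x y).PosSemidef := by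
  have h : rankOne' d x y = Matrix.vecMulVec ![x * psiNorm d 1, y * psiNorm d 0]
      (star ![x * psiNorm d 1, y * psiNorm d 0]) := by
    have h0 := psiNorm_zero_mul_self hd
    have h1 := psiNorm_one_mul_self hd
    have s0 := star_psiNorm d 0
    have s1 := star_psiNorm d 1
    rw [Complex.star_def] at s0 s1
    ext i j
    fin_cases i <;> fin_cases j <;> simp [rankOne', Matrix.vecMulVec_apply, s0, s1]
    · linear_combination (-(x * x : ℂ)) * h1
    · ring
    · ring
    · linear_combination (-(y * y : ℂ)) * h0
  rw [h]
  exact Matrix.posSemidef_vecMulVec_self_star _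

/-- The interchanged square roots make the inner product of the two vectors equal to `(x z + y w) ·
2 √(d² - 1)`. This is the orthogonality behind complementary slackness. -/
theorem rankOne_mul_rankOne' {d : ℕ} (hd : 2 ≤ d) {x y z w : ℝ} (h : x * z + y * w = 0) :
    rankOne d x y * rankOne' d z w = 0 := by
  have h0 := psiNorm_zero_mul_self hd
  have h1 := psiNorm_one_mul_self hd
  have h' : (x * z + y * w : ℂ) = 0 := by exact_mod_cast h
  have h2 : (psiNorm d 0 * psiNorm d 1) * (psiNorm d 0 * psiNorm d 1) =
      4 * ((d + 1) * (d - 1)) := by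
    calc _ = (psiNorm d 0 * psiNorm d 0) * (psiNorm d 1 * psiNorm d 1) := by ring
      _ = _ := by rw [h0, h1]; ring
  generalize hN : psiNorm d 0 * psiNorm d 1 = N at h2
  ext i j
  fin_cases i <;> fin_cases j <;> simp [rankOne, rankOne', hN, Matrix.mul_apply]
  · linear_combination (4 * x * z * (d + 1) * (d - 1) : ℂ) * h' + (x * y * z * w : ℂ) * h2
  · linear_combination (2 * x * w * (d + 1) * N : ℂ) * h'
  · linear_combination (2 * y * z * (d - 1) * N : ℂ) * h'
  · linear_combination (4 * y * w * (d + 1) * (d - 1) : ℂ) * h' + (x * y * z * w : ℂ) * h2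

/-- The blocks `P^α` of the operators `haarOperator`. -/
def omegaAlpha (d : ℕ) : OutcomeClass → Matrix (Fin 2) (Fin 2) ℂ
  | .xxx => !![2 / ((d : ℂ) * (d + 1)), 0; 0, 0]
  | .xxy => 0
  | .xyx => (1 / (4 * d * (d ^ 2 - 1)) : ℂ) • rankOne' d 1 1
  | .xyy => (1 / (4 * d * (d ^ 2 - 1)) : ℂ) • rankOne' d 1 (-1)
  | .xyz => 0

/-- The coefficients at `P^β` of the operators `haarOperator`. -/
def omegaBeta (d : ℕ) : OutcomeClass → ℝ
  | .xxx => 2 / ((d : ℝ) * (d + 1) * (d + 2))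
  | .xxy => 2 / ((d : ℝ) * (d - 1) * (d + 2))
  | .xyx => 1 / (((d : ℝ) - 1) * (d + 1) * (d + 2))
  | .xyy => 1 / (((d : ℝ) - 1) * (d + 1) * (d + 2))
  | .xyz => 1 / ((d : ℝ) * (d - 1) * (d + 2))

/-- The coefficients at `P^γ` of the operators `haarOperator`. -/
def omegaGamma (d : ℕ) : OutcomeClass → ℝ
  | .xxx => 0
  | .xxy => 0
  | .xyx => 1 / ((d : ℝ) * (d - 1) * (d + 1))
  | .xyy => 1 / ((d : ℝ) * (d - 1) * (d + 1))
  | .xyz => 1 / ((d : ℝ) * (d + 1) * (d - 2))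

theorem permSum_eq {d : ℕ} (a b c a' b' c' : Fin d) : permSum a' a b' b c c' =
    delta a a' * delta b b' * delta c c' + delta a b' * delta b a' * delta c c' +
    delta a c * delta a' c' * delta b b' + delta b c * delta b' c' * delta a a' +
    delta a c * delta b a' * delta b' c' + delta b c * delta a' c' * delta a b' := by
  unfold permSum
  rw [delta_comm a' a, delta_comm b' b, delta_comm a' b, delta_comm b' a, delta_comm c a,
    delta_comm c b]
  ring

theorem classOf_xxx {d : ℕ} (i : Fin d) : classOf i i i = .xxx := by simp [classOf]

theorem classOf_xxy {d : ℕ} {i k : Fin d} (h : i ≠ k) : classOf i i k = .xxy := by simp [classOf, h]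

theorem classOf_xyx {d : ℕ} {i j : Fin d} (h : i ≠ j) : classOf i j i = .xyx := by simp [classOf, h]

theorem classOf_xyy {d : ℕ} {i j : Fin d} (h : i ≠ j) : classOf i j j = .xyy := by simp [classOf, h]

theorem classOf_xyz {d : ℕ} {i j k : Fin d} (hij : i ≠ j) (hik : i ≠ k) (hjk : j ≠ k) :
    classOf i j k = .xyz := by simp [classOf, hij, hik, hjk]

theorem cast_ne_zero {d : ℕ} (hd : 2 ≤ d) : (d : ℂ) ≠ 0 := by exact_mod_cast (by omega : d ≠ 0)

theorem cast_add_one_ne_zero (d : ℕ) : (d : ℂ) + 1 ≠ 0 := by exact_mod_cast d.succ_ne_zero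

theorem cast_add_two_ne_zero (d : ℕ) : (d : ℂ) + 2 ≠ 0 := by exact_mod_cast (d + 1).succ_ne_zero

theorem cast_sub_one_ne_zero {d : ℕ} (hd : 2 ≤ d) : (d : ℂ) - 1 ≠ 0 := by
  rw [sub_ne_zero]; exact_mod_cast (show d ≠ 1 by omega)

theorem cast_sub_two_ne_zero {d : ℕ} (hd : 3 ≤ d) : (d : ℂ) - 2 ≠ 0 := by
  rw [sub_ne_zero]; exact_mod_cast (show d ≠ 2 by omega)

theorem sq_sub_one (d : ℕ) : (d : ℂ) ^ 2 - 1 = (d + 1) * (d - 1) := by ring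

theorem haarOperator_xxx {d : ℕ} (hd : 2 ≤ d) (i : Fin d) :
    haarOperator i i i = block d (omegaAlpha d .xxx) (omegaBeta d .xxx) (omegaGamma d .xxx) := by
  have h0 := cast_ne_zero hd
  have h1 := cast_add_one_ne_zero d
  have h2 := cast_add_two_ne_zero d
  have h3 := cast_sub_one_ne_zero hd
  ext ⟨⟨a, b⟩, c⟩ ⟨⟨a', b'⟩, c'⟩
  rw [block_apply hd, haarOperator, Matrix.of_apply, haarMoment_self (by omega), permSum_eq]
  simp [omegaAlpha, omegaBeta, omegaGamma]
  field_simp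
  ring

theorem haarOperator_xxy {d : ℕ} (hd : 2 ≤ d) {i k : Fin d} (h : i ≠ k) :
    haarOperator i i k = block d (omegaAlpha d .xxy) (omegaBeta d .xxy) (omegaGamma d .xxy) := by
  have h0 := cast_ne_zero hd
  have h1 := cast_add_one_ne_zero d
  have h2 := cast_add_two_ne_zero d
  have h3 := cast_sub_one_ne_zero hd
  ext ⟨⟨a, b⟩, c⟩ ⟨⟨a', b'⟩, c'⟩
  rw [block_apply hd, haarOperator, Matrix.of_apply, haarMoment_iik hd h, permSum_eq,
    delta_comm a' a, delta_comm b' b, delta_comm a' b, delta_comm b' a]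
  simp [omegaAlpha, omegaBeta, omegaGamma]
  field_simp
  ring

theorem haarOperator_xyx {d : ℕ} (hd : 2 ≤ d) {i j : Fin d} (h : i ≠ j) :
    haarOperator i j i = block d (omegaAlpha d .xyx) (omegaBeta d .xyx) (omegaGamma d .xyx) := by
  have h0 := cast_ne_zero hd
  have h1 := cast_add_one_ne_zero d
  have h2 := cast_add_two_ne_zero d
  have h3 := cast_sub_one_ne_zero hd
  have n0 := psiNorm_ne_zero hd 0
  have n1 := psiNorm_ne_zero hd 1
  ext ⟨⟨a, b⟩, c⟩ ⟨⟨a', b'⟩, c'⟩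
  rw [block_apply hd, haarOperator, Matrix.of_apply, haarMoment_iki, haarMoment_iik hd h,
    show permSum a' a c c' b' b = permSum a' a b' b c c' by unfold permSum; ring,
    permSum_eq, delta_comm a' a, delta_comm b' b, delta_comm c a]
  simp [omegaAlpha, omegaBeta, omegaGamma, rankOne', sq_sub_one]
  field_simp
  ring

theorem haarOperator_xyy {d : ℕ} (hd : 2 ≤ d) {i j : Fin d} (h : i ≠ j) :
    haarOperator i j j = block d (omegaAlpha d .xyy) (omegaBeta d .xyy) (omegaGamma d .xyy) := by
  have h0 := cast_ne_zero hd
  have h1 := cast_add_one_ne_zero d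
  have h2 := cast_add_two_ne_zero d
  have h3 := cast_sub_one_ne_zero hd
  have n0 := psiNorm_ne_zero hd 0
  have n1 := psiNorm_ne_zero hd 1
  ext ⟨⟨a, b⟩, c⟩ ⟨⟨a', b'⟩, c'⟩
  rw [block_apply hd, haarOperator, Matrix.of_apply, haarMoment_kii, haarMoment_iik hd h.symm,
    show permSum b' b c c' a' a = permSum a' a b' b c c' by unfold permSum; ring,
    permSum_eq, delta_comm a' a, delta_comm b' b, delta_comm c b]
  simp [omegaAlpha, omegaBeta, omegaGamma, rankOne', sq_sub_one]
  field_simp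
  ring

theorem haarOperator_xyz {d : ℕ} (hd : 3 ≤ d) {i j k : Fin d} (hij : i ≠ j) (hik : i ≠ k)
    (hjk : j ≠ k) :
    haarOperator i j k = block d (omegaAlpha d .xyz) (omegaBeta d .xyz) (omegaGamma d .xyz) := by
  have hd' : 2 ≤ d := by omega
  have h0 := cast_ne_zero hd'
  have h1 := cast_add_one_ne_zero d
  have h2 := cast_add_two_ne_zero d
  have h3 := cast_sub_one_ne_zero hd'
  have h4 := cast_sub_two_ne_zero hd
  ext ⟨⟨a, b⟩, c⟩ ⟨⟨a', b'⟩, c'⟩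
  -- The moment of three distinct outcomes is known through its multiple by `d - 2`.
  apply mul_left_cancel₀ h4
  rw [block_apply hd', haarOperator, Matrix.of_apply, haarMoment_ijk hd hij hik hjk,
    haarMoment₂_of_ne hd' hij, haarMoment_iki, haarMoment_iik hd' hij,
    haarMoment_kii, haarMoment_iik hd' hij.symm,
    show permSum a' a c c' b' b = permSum a' a b' b c c' by unfold permSum; ring,
    show permSum b' b c c' a' a = permSum a' a b' b c c' by unfold permSum; ring,
    permSum_eq, delta_comm a' a, delta_comm b' b, delta_comm a' b, delta_comm b' a, delta_comm c a,
    delta_comm c b]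
  simp [omegaAlpha, omegaBeta, omegaGamma]
  field_simp
  ring

theorem haarOperator_eq {d : ℕ} (hd : 2 ≤ d) (i j k : Fin d) :
    haarOperator i j k = block d (omegaAlpha d (classOf i j k)) (omegaBeta d (classOf i j k))
      (omegaGamma d (classOf i j k)) := by
  by_cases hij : i = j
  · subst hij
    by_cases hik : i = k
    · subst hik; rw [classOf_xxx]; exact haarOperator_xxx hd i
    · rw [classOf_xxy hik]; exact haarOperator_xxy hd hik
  · by_cases hik : i = k
    · subst hik; rw [classOf_xyx hij]; exact haarOperator_xyx hd hij
    · by_cases hjk : j = k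
      · subst hjk; rw [classOf_xyy hij]; exact haarOperator_xyy hd hij
      · have hd3 : 3 ≤ d := by
          have := Finset.card_le_univ ({i, j, k} : Finset (Fin d))
          rw [Finset.card_eq_three.2 ⟨i, j, k, hij, hik, hjk, rfl⟩, Fintype.card_fin] at this
          exact this
        rw [classOf_xyz hij hik hjk]; exact haarOperator_xyz hd3 hij hik hjk

/-! ### The fidelity as a linear functional of the slices -/

/-- The compression `⟨k| M |k⟩_D` of an operator on `H_A ⊗ H_B ⊗ H_C ⊗ H_D`. -/
def sliceD {d : ℕ} (M : Matrix (Four d) (Four d) ℂ) (k : Fin d) :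
    Matrix (Pair d × Fin d) (Pair d × Fin d) ℂ :=
  M.submatrix (fun u => (u.1, (u.2, k))) (fun u => (u.1, (u.2, k)))

theorem measurementChoi_apply {d : ℕ} (U : SU d) (c k c' k' : Fin d) :
    measurementChoi U (c', k') (c, k) = if k' = k then vonNeumann U k c c' else 0 := by
  rw [measurementChoi, Matrix.sum_apply]
  simp only [Matrix.kroneckerMap_apply, Matrix.transpose_apply, Matrix.single_apply]
  by_cases h : k' = k
  · subst h; simp
  · rw [if_neg h]
    refine Finset.sum_eq_zero fun i _ => ?_
    rw [if_neg (by rintro ⟨rfl, rfl⟩; exact h rfl), mul_zero]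

theorem replicated_apply {d : ℕ} (R : Pair d → Matrix (Four d) (Four d) ℂ) (U : SU d) (p : Pair d)
    (x y : Pair d) :
    replicated R U p x y =
      ∑ k, ∑ c, ∑ c', sliceD (R p) k (y, c') (x, c) * vonNeumann U k c c' := by
  simp only [replicated, linkProduct, partialTraceRight, partialTransposeRight,
    Matrix.transpose_apply, Matrix.of_apply, Matrix.mul_apply, Matrix.kroneckerMap_apply,
    Matrix.one_apply, sliceD, Matrix.submatrix_apply]
  rw [Fintype.sum_prod_type, Finset.sum_comm]
  refine Finset.sum_congr rfl fun k _ => Finset.sum_congr rfl fun c _ => ?_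
  rw [Fintype.sum_prod_type, Finset.sum_eq_single x]
  · rw [Fintype.sum_prod_type]
    refine Finset.sum_congr rfl fun c' _ => ?_
    rw [Finset.sum_eq_single k]
    · simp [measurementChoi_apply]
    · intro k' _ hk
      simp [measurementChoi_apply, hk]
    · simp
  · intro z _ hz
    simp [hz]
  · simp

/-- The operator `(E_i)ᵀ ⊗ (E_j)ᵀ ⊗ E_k`. -/
def tripleOperator {d : ℕ} (U : SU d) (i j k : Fin d) :
    Matrix (Pair d × Fin d) (Pair d × Fin d) ℂ :=
  Matrix.of fun x y => vonNeumann U i y.1.1 x.1.1 * vonNeumann U j y.1.2 x.1.2 *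
    vonNeumann U k x.2 y.2

theorem trace_replicated_mul {d : ℕ} (R : Pair d → Matrix (Four d) (Four d) ℂ) (U : SU d)
    (p : Pair d) :
    (replicated R U p * (vonNeumann U p.1 ⊗ₖ vonNeumann U p.2)).trace =
      ∑ k, (sliceD (R p) k * tripleOperator U p.1 p.2 k).trace := by
  simp only [Matrix.trace, Matrix.diag_apply, Matrix.mul_apply, replicated_apply, Finset.sum_mul]
  have e : ∀ k, (∑ u : Pair d × Fin d, ∑ v : Pair d × Fin d,
      sliceD (R p) k u v * tripleOperator U p.1 p.2 k v u) =
      ∑ x : Pair d, ∑ y : Pair d, ∑ c, ∑ c', sliceD (R p) k (y, c') (x, c) * vonNeumann U k c c' *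
        (vonNeumann U p.1 ⊗ₖ vonNeumann U p.2) y x := by
    intro k
    rw [Finset.sum_comm, Fintype.sum_prod_type]
    refine Finset.sum_congr rfl fun x _ => ?_
    rw [Finset.sum_comm]
    rw [Fintype.sum_prod_type]
    refine Finset.sum_congr rfl fun y _ => ?_
    rw [Finset.sum_comm]
    refine Finset.sum_congr rfl fun c _ => Finset.sum_congr rfl fun c' _ => ?_
    simp only [tripleOperator, Matrix.of_apply, Matrix.kroneckerMap_apply]
    ring
  simp only [e]
  symm
  rw [Finset.sum_comm]
  refine Finset.sum_congr rfl fun x _ => ?_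
  rw [Finset.sum_comm]

theorem averageFidelity_eq {d : ℕ} (R : Pair d → Matrix (Four d) (Four d) ℂ) :
    averageFidelity R = 1 / (d : ℝ) ^ 2 *
      ∑ p : Pair d, ∑ k, (sliceD (R p) k * haarOperator p.1 p.2 k).trace.re := by
  have hc : ∀ (p : Pair d) (k : Fin d),
      Continuous fun U : SU d => (sliceD (R p) k * tripleOperator U p.1 p.2 k).trace := by
    intro p k
    simp only [Matrix.trace, Matrix.diag_apply, Matrix.mul_apply, tripleOperator, Matrix.of_apply]
    fun_prop
  have hi : ∀ (p : Pair d) (k : Fin d),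
      ∫ U, (sliceD (R p) k * tripleOperator U p.1 p.2 k).trace ∂(haarSU d) =
        (sliceD (R p) k * haarOperator p.1 p.2 k).trace := by
    intro p k
    simp only [Matrix.trace, Matrix.diag_apply, Matrix.mul_apply, tripleOperator, haarOperator,
      Matrix.of_apply, haarMoment]
    rw [integral_finsetSum_haarSU (fun u => by fun_prop)]
    refine Finset.sum_congr rfl fun u _ => ?_
    rw [integral_finsetSum_haarSU (fun u => by fun_prop)]
    refine Finset.sum_congr rfl fun v _ => ?_
    rw [integral_const_mul]
  have hre : ∀ (f : SU d → ℂ), Continuous f →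
      ∫ U, (f U).re ∂(haarSU d) = (∫ U, f U ∂(haarSU d)).re := fun f hf =>
    Complex.reCLM.integral_comp_comm (integrable_haarSU hf)
  unfold averageFidelity povmFidelity
  rw [integral_const_mul]
  simp only [trace_replicated_mul, ← Complex.re_sum]
  rw [hre _ (by fun_prop), integral_finsetSum_haarSU (fun p => by fun_prop)]
  congr 1
  · simp [sq]
  · congr 1
    refine Finset.sum_congr rfl fun p _ => ?_
    rw [integral_finsetSum_haarSU (fun k => hc p k)]
    simp only [hi]

theorem sliceD_posSemidef {d : ℕ} {M : Matrix (Four d) (Four d) ℂ} (hM : M.PosSemidef)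
    (k : Fin d) : (sliceD M k).PosSemidef :=
  hM.submatrix _

theorem sum_sliceD {d : ℕ} {R : Pair d → Matrix (Four d) (Four d) ℂ}
    {ρ : Matrix (Fin d) (Fin d) ℂ}
    (h : ∑ p, R p = (1 : Matrix (Pair d) (Pair d) ℂ) ⊗ₖ (ρ ⊗ₖ (1 : Matrix (Fin d) (Fin d) ℂ)))
    (k : Fin d) : ∑ p, sliceD (R p) k = (1 : Matrix (Pair d) (Pair d) ℂ) ⊗ₖ ρ := by
  ext u v
  have := congrFun (congrFun h (u.1, (u.2, k))) (v.1, (v.2, k))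
  rw [Matrix.sum_apply] at this ⊢
  simpa [sliceD] using this

/-- The partial trace over `AB` of a covariant operator is a multiple of `I_C`. The weights are the
ranks divided by `d`: `1` for each diagonal `α` unit, `(d² ± d)/2 - 1` for `P^β` and `P^γ`. -/
theorem trace_kronecker_mul_block {d : ℕ} (hd : 2 ≤ d) (ρ : Matrix (Fin d) (Fin d) ℂ)
    (r : Matrix (Fin 2) (Fin 2) ℂ) (x y : ℂ) :
    (((1 : Matrix (Pair d) (Pair d) ℂ) ⊗ₖ ρ) * block d r x y).trace =
      (r 0 0 + r 1 1 + x * ((d ^ 2 + d) / 2 - 1) + y * ((d ^ 2 - d) / 2 - 1)) * ρ.trace := by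
  have h1 := cast_add_one_ne_zero d
  have h3 := cast_sub_one_ne_zero hd
  have n0 := psiNorm_ne_zero hd 0
  have n1 := psiNorm_ne_zero hd 1
  have key : ∀ c c' : Fin d, ∑ a, ∑ b, block d r x y ((a, b), c') ((a, b), c) =
      (r 0 0 + r 1 1 + x * ((d ^ 2 + d) / 2 - 1) + y * ((d ^ 2 - d) / 2 - 1)) * delta c' c := by
    intro c c'
    have e1 : ∀ X : ℂ, ∑ a : Fin d, ∑ b : Fin d, X * (delta a a * delta b b * delta c' c) =
        X * (d ^ 2 * delta c' c) := by
      intro X; simp [delta_self]; ring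
    have e2 : ∀ X : ℂ, ∑ a : Fin d, ∑ b : Fin d, X * (delta a b * delta b a * delta c' c) =
        X * (d * delta c' c) := by
      intro X
      simp only [← Finset.mul_sum, mul_assoc, sum_delta_mul, delta_self]
      simp
    have e3 : ∀ X : ℂ, ∑ a : Fin d, ∑ b : Fin d, X * (delta a c' * delta a c * delta b b) =
        X * (d * delta c' c) := by
      intro X
      simp only [← Finset.mul_sum, mul_assoc, sum_delta_mul', delta_self]
      simp [mul_comm]
    have e4 : ∀ X : ℂ, ∑ a : Fin d, ∑ b : Fin d, X * (delta b c' * delta b c * delta a a) =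
        X * (d * delta c' c) := by
      intro X
      simp only [← Finset.mul_sum, mul_assoc, sum_delta_mul', delta_self]
      simp [mul_comm]
    have e5 : ∀ X : ℂ, ∑ a : Fin d, ∑ b : Fin d, X * (delta a c' * delta b a * delta b c) =
        X * delta c' c := by
      intro X
      simp only [← Finset.mul_sum, mul_assoc, sum_delta_mul']
    have e6 : ∀ X : ℂ, ∑ a : Fin d, ∑ b : Fin d, X * (delta b c' * delta a c * delta a b) =
        X * delta c' c := by
      intro X
      rw [Finset.sum_comm]
      simp only [← Finset.mul_sum, mul_assoc, sum_delta_mul']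
      rw [delta_comm]
    simp only [block_apply hd, Finset.sum_add_distrib, e1, e2, e3, e4, e5, e6]
    field_simp
    ring
  have e : (((1 : Matrix (Pair d) (Pair d) ℂ) ⊗ₖ ρ) * block d r x y).trace =
      ∑ c, ∑ c', ρ c c' * ∑ a, ∑ b, block d r x y ((a, b), c') ((a, b), c) := by
    have e0 : ∀ u : Pair d × Fin d, (((1 : Matrix (Pair d) (Pair d) ℂ) ⊗ₖ ρ) * block d r x y) u u =
        ∑ c', ρ u.2 c' * block d r x y (u.1, c') u := by
      intro u
      rw [Matrix.mul_apply, Fintype.sum_prod_type, Finset.sum_eq_single u.1]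
      · simp
      · intro z _ hz
        simp [hz.symm]
      · simp
    simp only [Matrix.trace, Matrix.diag_apply, e0]
    rw [Fintype.sum_prod_type, Finset.sum_comm]
    refine Finset.sum_congr rfl fun c _ => ?_
    rw [Finset.sum_comm]
    refine Finset.sum_congr rfl fun c' _ => ?_
    rw [← Fintype.sum_prod_type (f := fun ab : Pair d => block d r x y (ab, c') (ab, c)),
      Finset.mul_sum]
  rw [e]
  simp only [key]
  rw [Matrix.trace, Finset.mul_sum]
  refine Finset.sum_congr rfl fun c _ => ?_
  simp [delta, mul_comm]

/-! ### The dual certificate and the upper bound -/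

/-- The block `P^α` of the optimal dual operator. -/
def dualAlpha (d : ℕ) : Matrix (Fin 2) (Fin 2) ℂ :=
  !![2 / ((d : ℂ) * (d + 1)), 0; 0, 2 / (3 * (d : ℂ) * (d - 1))]

/-- The optimal dual operator. -/
def dualOperator (d : ℕ) : Matrix (Pair d × Fin d) (Pair d × Fin d) ℂ :=
  block d (dualAlpha d) (2 / ((d : ℝ) * (d - 1) * (d + 2)) : ℝ)
    (1 / ((d : ℝ) * (d + 1) * (d - 2)) : ℝ)

/-- The optimal value of the dual problem. -/
def dualValue (d : ℕ) : ℝ :=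
  1 / d * (2 / ((d : ℝ) * (d + 1)) + 2 / (3 * (d : ℝ) * (d - 1)) +
    2 / ((d : ℝ) * (d - 1) * (d + 2)) * (((d : ℝ) ^ 2 + d) / 2 - 1) +
    1 / ((d : ℝ) * (d + 1) * (d - 2)) * (((d : ℝ) ^ 2 - d) / 2 - 1))

theorem diag_posSemidef {x y : ℝ} (hx : 0 ≤ x) (hy : 0 ≤ y) :
    (!![(x : ℂ), 0; 0, (y : ℂ)] : Matrix (Fin 2) (Fin 2) ℂ).PosSemidef := by
  have h : (!![(x : ℂ), 0; 0, (y : ℂ)] : Matrix (Fin 2) (Fin 2) ℂ) =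
      Matrix.diagonal ![(x : ℂ), (y : ℂ)] := by
    ext i j; fin_cases i <;> fin_cases j <;> simp
  rw [h, Matrix.posSemidef_diagonal_iff]
  intro i
  fin_cases i <;> simpa

/-- For `d = 2` the space `∧² ⊗ ℂ²` has dimension two and is already spanned by the two vectors
`Ψ^-_m`. -/
theorem projGamma_two : projGamma 2 = 0 := by
  have h : projGamma 2 = block 2 0 0 1 := by simp [block, alphaBlock]
  rw [h]
  ext ⟨⟨a, b⟩, c⟩ ⟨⟨a', b'⟩, c'⟩
  rw [block_apply le_rfl]
  fin_cases a <;> fin_cases b <;> fin_cases c <;> fin_cases a' <;> fin_cases b' <;> fin_cases c' <;>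
    simp [delta] <;> norm_num

theorem block_posSemidef' {d : ℕ} (hd : 2 ≤ d) {r : Matrix (Fin 2) (Fin 2) ℂ} (hr : r.PosSemidef)
    {x y : ℝ} (hx : 0 ≤ x) (hy : 3 ≤ d → 0 ≤ y) : (block d r x y).PosSemidef := by
  rcases hd.eq_or_lt with rfl | hd3
  · have : block 2 r x y = block 2 r x (0 : ℝ) := by simp [block, projGamma_two]
    rw [this]
    exact block_posSemidef le_rfl hr hx le_rfl
  · exact block_posSemidef hd hr hx (hy hd3)

theorem dualAlpha_posSemidef {d : ℕ} (hd : 2 ≤ d) : (dualAlpha d).PosSemidef := by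
  have hd' : (2 : ℝ) ≤ d := by exact_mod_cast hd
  have h1 : (0 : ℝ) < d - 1 := by linarith
  have h := diag_posSemidef (x := 2 / ((d : ℝ) * (d + 1))) (y := 2 / (3 * (d : ℝ) * (d - 1)))
    (by positivity) (by positivity)
  push_cast at h
  exact h

theorem dualAlpha_sub_xxx (d : ℕ) :
    dualAlpha d - omegaAlpha d .xxx = !![((0 : ℝ) : ℂ), 0; 0, ((2 / (3 * (d : ℝ) * (d - 1)) : ℝ) : ℂ)] := by
  ext i j
  fin_cases i <;> fin_cases j <;> simp [dualAlpha, omegaAlpha]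

/-- The first diagonal entry of the dual block is forced by the class `xxx`. Given it, `2/(3d(d-1))`
is the least second entry that dominates `|w⟩⟨w| = omegaAlpha d .xyx`: the condition `w₀²/p + w₁²/q
≤ 1` becomes the equality `1/4 + 3/4 = 1`. Hence the difference is singular, again of rank one. -/
theorem dualAlpha_sub_xyx {d : ℕ} (hd : 2 ≤ d) : dualAlpha d - omegaAlpha d .xyx =
    ((1 / (12 * d * ((d + 1) * (d - 1))) : ℝ) : ℂ) • rankOne' d 3 (-1) := by
  have c0 := cast_ne_zero hd
  have c1 := cast_add_one_ne_zero d
  have c3 := cast_sub_one_ne_zero hd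
  ext i j
  fin_cases i <;> fin_cases j <;> simp [dualAlpha, omegaAlpha, rankOne', sq_sub_one] <;>
    field_simp <;> ring

theorem dualAlpha_sub_xyy {d : ℕ} (hd : 2 ≤ d) : dualAlpha d - omegaAlpha d .xyy =
    ((1 / (12 * d * ((d + 1) * (d - 1))) : ℝ) : ℂ) • rankOne' d 3 1 := by
  have c0 := cast_ne_zero hd
  have c1 := cast_add_one_ne_zero d
  have c3 := cast_sub_one_ne_zero hd
  ext i j
  fin_cases i <;> fin_cases j <;> simp [dualAlpha, omegaAlpha, rankOne', sq_sub_one] <;>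
    field_simp <;> ring

theorem dualAlpha_sub_posSemidef {d : ℕ} (hd : 2 ≤ d) (c : OutcomeClass) :
    (dualAlpha d - omegaAlpha d c).PosSemidef := by
  have hd' : (2 : ℝ) ≤ d := by exact_mod_cast hd
  have h1 : (0 : ℝ) < d - 1 := by linarith
  have hc : (0 : ℂ) ≤ ((1 / (12 * d * ((d + 1) * (d - 1))) : ℝ) : ℂ) := by
    rw [Complex.zero_le_real]; positivity
  cases c
  · rw [dualAlpha_sub_xxx]
    exact diag_posSemidef le_rfl (by positivity)
  · rw [omegaAlpha, sub_zero]; exact dualAlpha_posSemidef hd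
  · rw [dualAlpha_sub_xyx hd]; exact (rankOne'_posSemidef hd _ _).smul hc
  · rw [dualAlpha_sub_xyy hd]; exact (rankOne'_posSemidef hd _ _).smul hc
  · rw [omegaAlpha, sub_zero]; exact dualAlpha_posSemidef hd

/-- The dual operator dominates the Haar averages. -/
theorem dualOperator_sub_posSemidef {d : ℕ} (hd : 2 ≤ d) (i j k : Fin d) :
    (dualOperator d - haarOperator i j k).PosSemidef := by
  rw [haarOperator_eq hd, dualOperator, block_sub, ← Complex.ofReal_sub, ← Complex.ofReal_sub]
  have hd' : (2 : ℝ) ≤ d := by exact_mod_cast hd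
  have h0 : (0 : ℝ) < d := by linarith
  have h1 : (0 : ℝ) < d - 1 := by linarith
  have h2 : (0 : ℝ) ≤ d - 2 := by linarith
  -- The `β` and `γ` coefficients of the dual operator are the largest ones among the classes,
  -- attained at `xxy` and `xyz`. At `d = 2` the `γ` coefficient is `1/0 = 0` and dominates nothing,
  -- which is harmless since `P^γ = 0`.
  refine block_posSemidef' hd (dualAlpha_sub_posSemidef hd _) ?_ ?_
  · rw [sub_nonneg]
    cases classOf i j k <;> simp only [omegaBeta]
    · gcongr; linarith
    · exact le_rfl
    · rw [div_le_div_iff₀ (by positivity) (by positivity)]; nlinarith [mul_pos h0 h1, mul_pos (mul_pos h0 h1) h0]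
    · rw [div_le_div_iff₀ (by positivity) (by positivity)]; nlinarith [mul_pos h0 h1, mul_pos (mul_pos h0 h1) h0]
    · gcongr; norm_num
  · intro hd3
    have hd3' : (3 : ℝ) ≤ d := by exact_mod_cast hd3
    have h3 : (0 : ℝ) < d - 2 := by linarith
    rw [sub_nonneg]
    cases classOf i j k <;> simp only [omegaGamma]
    · positivity
    · positivity
    · rw [div_le_div_iff₀ (by positivity) (by positivity)]; nlinarith [mul_pos h0 h1]
    · rw [div_le_div_iff₀ (by positivity) (by positivity)]; nlinarith [mul_pos h0 h1]
    · exact le_rfl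

/-- The duality gap. -/
theorem averageFidelity_eq_sub {d : ℕ} (hd : 2 ≤ d) {R : Pair d → Matrix (Four d) (Four d) ℂ}
    (hR : IsLearningInstrument R) :
    averageFidelity R = dualValue d - 1 / (d : ℝ) ^ 2 * ∑ p : Pair d, ∑ k,
      (sliceD (R p) k * (dualOperator d - haarOperator p.1 p.2 k)).trace.re := by
  obtain ⟨-, ρ, -, hρ, hsum⟩ := hR
  -- Every slice index `k` gives the same constraint and the same value; the sum over `k` supplies
  -- the second factor `d` that cancels `1/d²`.
  have h : ∀ k, ∑ p : Pair d, (sliceD (R p) k * dualOperator d).trace.re = d * dualValue d := by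
    intro k
    rw [← Complex.re_sum, ← Matrix.trace_sum, ← Matrix.sum_mul, sum_sliceD hsum, dualOperator,
      trace_kronecker_mul_block hd, hρ, mul_one]
    rw [dualValue, ← mul_assoc, mul_one_div_cancel (by exact_mod_cast (by omega : d ≠ 0)), one_mul]
    refine (congrArg Complex.re ?_).trans (Complex.ofReal_re _)
    push_cast
    simp [dualAlpha]
  have h0 : (d : ℝ) ≠ 0 := by exact_mod_cast (by omega : d ≠ 0)
  simp only [mul_sub, Matrix.trace_sub, Complex.sub_re, Finset.sum_sub_distrib]
  rw [averageFidelity_eq, Finset.sum_comm (f := fun p k => (sliceD (R p) k * dualOperator d).trace.re)]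
  simp only [h, Finset.sum_const, Finset.card_univ, Fintype.card_fin, nsmul_eq_mul]
  field_simp
  ring

theorem averageFidelity_le {d : ℕ} (hd : 2 ≤ d) {R : Pair d → Matrix (Four d) (Four d) ℂ}
    (hR : IsLearningInstrument R) : averageFidelity R ≤ dualValue d := by
  rw [averageFidelity_eq_sub hd hR]
  have : 0 ≤ ∑ p : Pair d, ∑ k,
      (sliceD (R p) k * (dualOperator d - haarOperator p.1 p.2 k)).trace.re :=
    Finset.sum_nonneg fun p _ => Finset.sum_nonneg fun k _ =>
      re_trace_mul_nonneg (sliceD_posSemidef (hR.1 p) k) (dualOperator_sub_posSemidef hd _ _ _)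
  have h2 : 0 ≤ 1 / (d : ℝ) ^ 2 := by positivity
  nlinarith [mul_nonneg h2 this]

/-! ### Feasibility and optimality of the explicit instrument -/

theorem sliceD_learningInstrument (d : ℕ) (a : ℝ) (p : Pair d) (k : Fin d) :
    sliceD (learningInstrument d a p) k = diagBlock d a p.1 p.2 k := by
  ext u v
  simp only [sliceD, learningInstrument, Matrix.submatrix_apply, Matrix.sum_apply,
    Matrix.reindex_apply, Equiv.prodAssoc_symm_apply, Matrix.kroneckerMap_apply,
    Matrix.single_apply, and_self]
  simp

theorem diagBlock_eq (d : ℕ) (a : ℝ) (i j k : Fin d) :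
    diagBlock d a i j k = ((d : ℂ) / classCard d (classOf i j k)) •
      block d (sAlpha d a (classOf i j k)) (sBeta d (classOf i j k)) (sGamma d (classOf i j k)) :=
  rfl

theorem sqrt_optParam {d : ℕ} (hd : 2 ≤ d) :
    ((√(optParam d / (2 * (d : ℝ))) : ℝ) : ℂ) =
      1 / (12 * d * (d - 1)) * (psiNorm d 0 * psiNorm d 1) := by
  have hd' : (2 : ℝ) ≤ d := by exact_mod_cast hd
  have h0 : (0 : ℝ) < d := by linarith
  have h1 : (0 : ℝ) < d - 1 := by linarith
  have h : √(optParam d / (2 * (d : ℝ))) = 1 / (12 * d * (d - 1)) *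
      (√(2 * ((d : ℝ) + (-1) ^ ((0 : Fin 2) : ℕ))) * √(2 * ((d : ℝ) + (-1) ^ ((1 : Fin 2) : ℕ)))) := by
    rw [← Real.sqrt_sq (x := 1 / (12 * d * (d - 1)) * _) (by positivity)]
    congr 1
    rw [mul_pow, mul_pow, Real.sq_sqrt (by simp; linarith), Real.sq_sqrt (by simp; linarith),
      optParam]
    simp
    field_simp
    ring
  rw [h]
  push_cast [psiNorm]
  rfl

/-- At the optimal parameter the block is supported on the kernel of `dualAlpha - omegaAlpha`. The
vector with weights `(1, 3)` is orthogonal to the one with weights `(3, -1)`; the entry `1/(2d)`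
fixes the scale, and with it `a`. -/
theorem sAlpha_xyx {d : ℕ} (hd : 2 ≤ d) :
    sAlpha d (optParam d) .xyx = (1 / (36 * d * (d - 1)) : ℂ) • rankOne d 1 3 := by
  have c0 := cast_ne_zero hd
  have c3 := cast_sub_one_ne_zero hd
  rw [sAlpha, sqrt_optParam hd]
  ext i j
  fin_cases i <;> fin_cases j <;> simp [rankOne, optParam] <;> field_simp <;> ring

theorem sAlpha_xyy {d : ℕ} (hd : 2 ≤ d) :
    sAlpha d (optParam d) .xyy = (1 / (36 * d * (d - 1)) : ℂ) • rankOne d 1 (-3) := by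
  have c0 := cast_ne_zero hd
  have c3 := cast_sub_one_ne_zero hd
  rw [sAlpha, sqrt_optParam hd]
  ext i j
  fin_cases i <;> fin_cases j <;> simp [rankOne, optParam] <;> field_simp <;> ring

/-- Complementary slackness. -/
theorem diagBlock_mul_eq_zero {d : ℕ} (hd : 2 ≤ d) (i j k : Fin d) :
    diagBlock d (optParam d) i j k * (dualOperator d - haarOperator i j k) = 0 := by
  rw [diagBlock_eq, haarOperator_eq hd, dualOperator, block_sub, Matrix.smul_mul, block_mul hd]
  have key : ∀ c : OutcomeClass, block d
      (sAlpha d (optParam d) c * (dualAlpha d - omegaAlpha d c))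
      (sBeta d c * (((2 / ((d : ℝ) * (d - 1) * (d + 2)) : ℝ) : ℂ) - omegaBeta d c))
      (sGamma d c * (((1 / ((d : ℝ) * (d + 1) * (d - 2)) : ℝ) : ℂ) - omegaGamma d c)) = 0 := by
    intro c
    cases c
    -- The block lives on `|+⟩`, where the dual constraint of `xxx` is tight; only its `|-⟩` entry
    -- has slack.
    · have : sAlpha d (optParam d) .xxx * (dualAlpha d - omegaAlpha d .xxx) = 0 := by
        rw [dualAlpha_sub_xxx, sAlpha]
        ext i j
        fin_cases i <;> fin_cases j <;> simp
      simp [this, sBeta, sGamma, block_zero]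
    · simp [sAlpha, sBeta, sGamma, omegaBeta, block_zero]
    · have : sAlpha d (optParam d) .xyx * (dualAlpha d - omegaAlpha d .xyx) = 0 := by
        rw [dualAlpha_sub_xyx hd, sAlpha_xyx hd, smul_mul_smul_comm,
          rankOne_mul_rankOne' hd (by norm_num), smul_zero]
      simp [this, sBeta, sGamma, block_zero]
    · have : sAlpha d (optParam d) .xyy * (dualAlpha d - omegaAlpha d .xyy) = 0 := by
        rw [dualAlpha_sub_xyy hd, sAlpha_xyy hd, smul_mul_smul_comm,
          rankOne_mul_rankOne' hd (by norm_num), smul_zero]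
      simp [this, sBeta, sGamma, block_zero]
    · simp [sAlpha, sBeta, sGamma, omegaGamma, block_zero]
  rw [key, smul_zero]

theorem diagBlock_posSemidef {d : ℕ} (hd : 2 ≤ d) (i j k : Fin d) :
    (diagBlock d (optParam d) i j k).PosSemidef := by
  rw [diagBlock_eq]
  have hd' : (2 : ℝ) ≤ d := by exact_mod_cast hd
  have h1 : (0 : ℝ) < d - 1 := by linarith
  have h2 : (0 : ℝ) ≤ d - 2 := by linarith
  have hα : ∀ c, (sAlpha d (optParam d) c).PosSemidef := by
    have hc : (0 : ℂ) ≤ 1 / (36 * d * (d - 1)) := by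
      have : (1 / (36 * d * (d - 1)) : ℂ) = ((1 / (36 * d * (d - 1)) : ℝ) : ℂ) := by push_cast; rfl
      rw [this, Complex.zero_le_real]; positivity
    intro c
    cases c
    -- The inequality `2a ≤ 1/d` amounts to `d + 1 ≤ 9 (d - 1)`.
    · have h := diag_posSemidef (x := 1 / (d : ℝ) - 2 * optParam d) (y := 0) (by
        rw [sub_nonneg, optParam, ← mul_div_assoc, div_le_div_iff₀ (by positivity) (by positivity)]
        nlinarith) le_rfl
      push_cast at h
      exact h
    · exact Matrix.PosSemidef.zero
    · rw [sAlpha_xyx hd]; exact (rankOne_posSemidef hd _ _).smul hc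
    · rw [sAlpha_xyy hd]; exact (rankOne_posSemidef hd _ _).smul hc
    · exact Matrix.PosSemidef.zero
  have hβ : ∀ c, ∃ x : ℝ, 0 ≤ x ∧ sBeta d c = x := by
    intro c
    cases c
    case xxy => exact ⟨1 / d, by positivity, by simp [sBeta]⟩
    all_goals exact ⟨0, le_rfl, by simp [sBeta]⟩
  have hγ : ∀ c, ∃ x : ℝ, 0 ≤ x ∧ sGamma d c = x := by
    intro c
    cases c
    case xyz => exact ⟨1 / d, by positivity, by simp [sGamma]⟩
    all_goals exact ⟨0, le_rfl, by simp [sGamma]⟩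
  have hn : ∀ c, ∃ x : ℝ, 0 ≤ x ∧ (d : ℂ) / classCard d c = x := by
    intro c
    cases c
    · exact ⟨d / d, by positivity, by simp [classCard]⟩
    · exact ⟨d / (d * (d - 1)), by positivity, by simp [classCard]⟩
    · exact ⟨d / (d * (d - 1)), by positivity, by simp [classCard]⟩
    · exact ⟨d / (d * (d - 1)), by positivity, by simp [classCard]⟩
    · exact ⟨d / (d * (d - 1) * (d - 2)), by positivity, by simp [classCard]⟩
  obtain ⟨x, hx, ex⟩ := hβ (classOf i j k)
  obtain ⟨y, hy, ey⟩ := hγ (classOf i j k)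
  obtain ⟨n, hn, en⟩ := hn (classOf i j k)
  rw [ex, ey, en]
  exact (block_posSemidef hd (hα _) hx hy).smul (Complex.zero_le_real.2 hn)

theorem sum_classOf {d : ℕ} {M : Type} [AddCommMonoid M] (g : OutcomeClass → M) (k : Fin d) :
    ∑ p : Pair d, g (classOf p.1 p.2 k) = g .xxx + (d - 1) • (g .xyx + g .xxy + g .xyy) +
      ((d - 1) * (d - 2)) • g .xyz := by
  have h1 : ∑ j, g (classOf k j k) = g .xxx + (d - 1) • g .xyx := by
    rw [← Finset.add_sum_erase _ _ (Finset.mem_univ k), classOf_xxx,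
      Finset.sum_congr rfl (g := fun _ => g .xyx), Finset.sum_const,
      Finset.card_erase_of_mem (Finset.mem_univ k), Finset.card_univ, Fintype.card_fin]
    intro j hj
    rw [classOf_xyx (Finset.ne_of_mem_erase hj).symm]
  have h2 : ∀ i ∈ Finset.univ.erase k,
      ∑ j, g (classOf i j k) = g .xxy + g .xyy + (d - 2) • g .xyz := by
    intro i hi
    have hik := Finset.ne_of_mem_erase hi
    have hk : k ∈ Finset.univ.erase i := Finset.mem_erase.2 ⟨hik.symm, Finset.mem_univ k⟩
    rw [← Finset.add_sum_erase _ _ (Finset.mem_univ i), ← Finset.add_sum_erase _ _ hk,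
      classOf_xxy hik, classOf_xyy hik, Finset.sum_congr rfl (g := fun _ => g .xyz),
      Finset.sum_const, Finset.card_erase_of_mem hk,
      Finset.card_erase_of_mem (Finset.mem_univ i), Finset.card_univ, Fintype.card_fin, add_assoc]
    · rfl
    · intro j hj
      rw [classOf_xyz (Finset.ne_of_mem_erase (Finset.mem_of_mem_erase hj)).symm hik
        (Finset.ne_of_mem_erase hj)]
  rw [Fintype.sum_prod_type, ← Finset.add_sum_erase _ _ (Finset.mem_univ k), h1,
    Finset.sum_congr rfl h2, Finset.sum_const, Finset.card_erase_of_mem (Finset.mem_univ k),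
    Finset.card_univ, Fintype.card_fin, mul_smul]
  simp only [smul_add]
  abel

/-- For fixed `k` a class contains `classCard / d` pairs, which the prefactor `d / classCard`
undoes; so the blocks `s` only have to add up to `1/d`. This holds for every `a`: it cancels on
`|+⟩`, as do the off-diagonal square roots. -/
theorem sum_diagBlock {d : ℕ} (hd : 2 ≤ d) (a : ℝ) (k : Fin d) :
    ∑ p : Pair d, diagBlock d a p.1 p.2 k = (1 / d : ℂ) • 1 := by
  simp only [diagBlock_eq]
  rw [sum_classOf (fun c => ((d : ℂ) / classCard d c) • block d (sAlpha d a c) (sBeta d c) (sGamma d c))]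
  have c0 := cast_ne_zero hd
  have c3 := cast_sub_one_ne_zero hd
  have e1 : ((d - 1 : ℕ) : ℂ) = d - 1 := by rw [Nat.cast_sub (by omega)]; simp
  have e2 : ((d - 2 : ℕ) : ℂ) = d - 2 := by rw [Nat.cast_sub (by omega)]; simp
  have h1 : ∀ M : Matrix (Pair d × Fin d) (Pair d × Fin d) ℂ,
      (d - 1) • (((d : ℂ) / (d * (d - 1))) • M) = M := by
    intro M
    rw [← Nat.cast_smul_eq_nsmul ℂ, smul_smul, e1]
    have : ((d : ℂ) - 1) * (d / (d * (d - 1))) = 1 := by field_simp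
    rw [this, one_smul]
  have h2 : ((d - 1) * (d - 2)) • (((d : ℂ) / (d * (d - 1) * (d - 2))) • block d 0 0 (1 / d)) =
      block d 0 0 (1 / d) := by
    -- For `d = 2` there are no strings of type `xyz`, the prefactor is a division by zero, and both
    -- sides vanish because `P^γ = 0`.
    rcases hd.eq_or_lt with rfl | hd3
    · simp [block, projGamma_two, alphaBlock_zero]
    · have c4 := cast_sub_two_ne_zero hd3
      rw [← Nat.cast_smul_eq_nsmul ℂ, smul_smul, Nat.cast_mul, e1, e2]
      have : ((d : ℂ) - 1) * (d - 2) * (d / (d * (d - 1) * (d - 2))) = 1 := by field_simp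
      rw [this, one_smul]
  simp only [classCard, div_self c0, one_smul, smul_add, h1, sBeta, sGamma]
  rw [show sAlpha d a .xyz = 0 from rfl, h2, show sAlpha d a .xxy = 0 from rfl, block_add, block_add,
    block_add, block_add, ← block_one, block_smul]
  congr 1
  · ext i j
    fin_cases i <;> fin_cases j <;> simp [sAlpha] <;> ring
  · simp
  · simp

theorem isLearningInstrument_learningInstrument {d : ℕ} (hd : 2 ≤ d) :
    IsLearningInstrument (learningInstrument d (optParam d)) := by
  have hd1 : (d : ℂ) ≠ 0 := cast_ne_zero hd
  refine ⟨fun p => ?_, (1 / d : ℂ) • 1, ?_, ?_, ?_⟩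
  · refine Matrix.posSemidef_sum _ fun k _ => ?_
    refine Matrix.PosSemidef.submatrix ((diagBlock_posSemidef hd _ _ _).kronecker ?_) _
    have : Matrix.single k k (1 : ℂ) = Matrix.diagonal (Pi.single k 1) := by
      rw [Matrix.diagonal_single]
    rw [this, Matrix.posSemidef_diagonal_iff]
    intro i
    by_cases h : i = k
    · subst h; simp
    · simp [h]
  · refine Matrix.PosSemidef.one.smul ?_
    have : (1 / d : ℂ) = ((1 / d : ℝ) : ℂ) := by push_cast; rfl
    rw [this, Complex.zero_le_real]; positivity
  · simp [hd1]
  · unfold learningInstrument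
    rw [Finset.sum_comm]
    ext ⟨x, c, l⟩ ⟨y, c', l'⟩
    have h : ∀ k, (∑ p : Pair d, diagBlock d (optParam d) p.1 p.2 k (x, c) (y, c')) =
        ((1 / d : ℂ) • (1 : Matrix (Pair d × Fin d) (Pair d × Fin d) ℂ)) (x, c) (y, c') := by
      intro k
      rw [← sum_diagBlock hd (optParam d) k, Matrix.sum_apply]
    simp only [Matrix.sum_apply, Matrix.reindex_apply, Matrix.submatrix_apply,
      Equiv.prodAssoc_symm_apply, Matrix.kroneckerMap_apply, ← Finset.sum_mul, h]
    by_cases h1 : x = y <;> by_cases h2 : c = c' <;> by_cases h3 : l = l' <;>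
      simp [h1, h2, h3, Matrix.single_apply, Matrix.one_apply]
    exact Finset.sum_eq_zero fun z _ => if_neg (by rintro ⟨rfl, h⟩; exact h3 h)

theorem averageFidelity_learningInstrument {d : ℕ} (hd : 2 ≤ d) :
    averageFidelity (learningInstrument d (optParam d)) = dualValue d := by
  rw [averageFidelity_eq_sub hd (isLearningInstrument_learningInstrument hd)]
  simp [sliceD_learningInstrument, diagBlock_mul_eq_zero hd]

theorem isGreatest_learningFidelities {d : ℕ} (hd : 2 ≤ d) :
    IsGreatest (learningFidelities d) (dualValue d) :=
  ⟨⟨_, isLearningInstrument_learningInstrument hd, (averageFidelity_learningInstrument hd).symm⟩, by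
    rintro _ ⟨R, hR, rfl⟩; exact averageFidelity_le hd hR⟩

/-! ### The replicated measurement -/

/-- The operator `[M * Eᵀ]ᵀ` on `H_A ⊗ H_B`, for `M` on `H_A ⊗ H_B ⊗ H_C` and `E` on `H_C`. -/
def linkC {d : ℕ} (M : Matrix (Pair d × Fin d) (Pair d × Fin d) ℂ) (E : Matrix (Fin d) (Fin d) ℂ) :
    Matrix (Pair d) (Pair d) ℂ :=
  Matrix.of fun x y => ∑ c, ∑ c', M (y, c') (x, c) * E c c'

theorem replicated_learningInstrument (d : ℕ) (a : ℝ) (U : SU d) (p : Pair d) :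
    replicated (learningInstrument d a) U p =
      ∑ k, linkC (diagBlock d a p.1 p.2 k) (vonNeumann U k) := by
  ext x y
  simp [replicated_apply, Matrix.sum_apply, linkC, sliceD_learningInstrument]

theorem linkC_add {d : ℕ} (M N : Matrix (Pair d × Fin d) (Pair d × Fin d) ℂ)
    (E : Matrix (Fin d) (Fin d) ℂ) : linkC (M + N) E = linkC M E + linkC N E := by
  ext x y
  simp [linkC, add_mul, Finset.sum_add_distrib]

theorem linkC_smul {d : ℕ} (z : ℂ) (M : Matrix (Pair d × Fin d) (Pair d × Fin d) ℂ)
    (E : Matrix (Fin d) (Fin d) ℂ) : linkC (z • M) E = z • linkC M E := by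
  ext x y
  simp [linkC, Finset.mul_sum, mul_assoc]

theorem linkC_sub {d : ℕ} (M N : Matrix (Pair d × Fin d) (Pair d × Fin d) ℂ)
    (E : Matrix (Fin d) (Fin d) ℂ) : linkC (M - N) E = linkC M E - linkC N E := by
  ext x y
  simp [linkC, sub_mul, Finset.sum_sub_distrib]

theorem projPM_mul_apply {d : ℕ} (s : Fin 2) (M : Matrix (Pair d) (Pair d) ℂ) (a b : Fin d)
    (y : Pair d) :
    (projPM d s * M) (a, b) y = (M (a, b) y + (-1) ^ (s : ℕ) * M (b, a) y) / 2 := by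
  rw [Matrix.mul_apply, Fintype.sum_prod_type]
  have e : ∀ x y' : Fin d, projPM d s (a, b) (x, y') * M (x, y') y =
      delta b y' * (delta a x * (M (x, y') y / 2)) +
      delta a y' * (delta b x * ((-1) ^ (s : ℕ) * M (x, y') y / 2)) := by
    intro x y'; rw [projPM_apply]; ring
  simp only [e, Finset.sum_add_distrib, sum_delta_mul]
  ring

theorem mul_projPM_apply {d : ℕ} (s : Fin 2) (M : Matrix (Pair d) (Pair d) ℂ) (a b : Fin d)
    (x : Pair d) :
    (M * projPM d s) x (a, b) = (M x (a, b) + (-1) ^ (s : ℕ) * M x (b, a)) / 2 := by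
  have h : (M * projPM d s) x (a, b) = star ((projPM d s * Mᴴ) (a, b) x) := by
    rw [← Matrix.conjTranspose_apply, Matrix.conjTranspose_mul, Matrix.conjTranspose_conjTranspose,
      projPM_isHermitian]
  rw [h, projPM_mul_apply]
  simp

/-- With `N_s = psiNorm d s`, `Ψ^s_m = (2/N_s) (P^s ⊗ I) |ω⟩_{AC}|m⟩_B`. Contracting `|ω⟩` with `E`
moves `E` to `A`, the sum over `m` gives `I_B`, and the transposition exchanges `s` and `t`. -/
theorem linkC_psiUnit {d : ℕ} (s t : Fin 2) (E : Matrix (Fin d) (Fin d) ℂ) :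
    linkC (psiUnit d s t) E = (4 / (psiNorm d s * psiNorm d t)) •
      (projPM d t * (E ⊗ₖ (1 : Matrix (Fin d) (Fin d) ℂ)) * projPM d s) := by
  ext ⟨a, b⟩ ⟨a', b'⟩
  rw [Matrix.smul_apply, mul_projPM_apply, projPM_mul_apply, projPM_mul_apply]
  have hone : ∀ x y : Fin d, (1 : Matrix (Fin d) (Fin d) ℂ) x y = delta x y := fun x y =>
    Matrix.one_apply
  simp only [linkC, Matrix.of_apply, psiUnit_apply, Matrix.kroneckerMap_apply, hone]
  generalize psiNorm d s * psiNorm d t = N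
  have e : ∀ c c' : Fin d, (delta a' c' * delta a c * delta b' b +
      (-1) ^ (t : ℕ) * (delta a' c' * delta b' a * delta b c) +
      (-1) ^ (s : ℕ) * (delta b' c' * delta a c * delta a' b) +
      (-1) ^ (s : ℕ) * (-1) ^ (t : ℕ) * (delta b' c' * delta b c * delta a' a)) / N * E c c' =
      delta a' c' * (delta a c * (delta b' b / N * E c c')) +
      delta a' c' * (delta b c * ((-1) ^ (t : ℕ) * delta b' a / N * E c c')) +
      delta b' c' * (delta a c * ((-1) ^ (s : ℕ) * delta a' b / N * E c c')) +
      delta b' c' * (delta b c * ((-1) ^ (s : ℕ) * (-1) ^ (t : ℕ) * delta a' a / N * E c c')) := by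
    intro c c'; ring
  simp only [e, Finset.sum_add_distrib, sum_delta_mul]
  rw [delta_comm b' b, delta_comm b' a, delta_comm a' b, delta_comm a' a, smul_eq_mul]
  ring

theorem linkC_projABC {d : ℕ} (s : Fin 2) {E : Matrix (Fin d) (Fin d) ℂ} (hE : E.trace = 1) :
    linkC (projABC d s) E = projPM d s := by
  ext ⟨a, b⟩ ⟨a', b'⟩
  simp only [linkC, Matrix.of_apply, projABC_apply]
  have e : ∀ c, ∑ c', (delta a' a * delta b' b + (-1) ^ (s : ℕ) * (delta a' b * delta b' a)) / 2 *
      delta c' c * E c c' = projPM d s (a, b) (a', b') * E c c := by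
    intro c
    simp only [mul_assoc, ← Finset.mul_sum, sum_delta_mul']
    rw [projPM_apply, delta_comm a' a, delta_comm b' b, delta_comm a' b, delta_comm b' a,
      mul_comm (delta b a')]
  simp only [e, ← Finset.mul_sum]
  change _ * E.trace = _
  rw [hE, mul_one]

theorem linkC_block {d : ℕ} (hd : 2 ≤ d) (r : Matrix (Fin 2) (Fin 2) ℂ) (x y : ℂ)
    {E : Matrix (Fin d) (Fin d) ℂ} (hE : E.trace = 1) (A : Matrix (Pair d) (Pair d) ℂ)
    (hA : A = E ⊗ₖ (1 : Matrix (Fin d) (Fin d) ℂ)) :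
    linkC (block d r x y) E =
      (2 * r 0 0 / (d + 1)) • (projPM d 0 * A * projPM d 0) +
      (4 * r 0 1 / (psiNorm d 0 * psiNorm d 1)) • (projPM d 1 * A * projPM d 0) +
      (4 * r 1 0 / (psiNorm d 0 * psiNorm d 1)) • (projPM d 0 * A * projPM d 1) +
      (2 * r 1 1 / (d - 1)) • (projPM d 1 * A * projPM d 1) +
      x • (projPM d 0 - (2 / ((d : ℂ) + 1)) • (projPM d 0 * A * projPM d 0)) +
      y • (projPM d 1 - (2 / ((d : ℂ) - 1)) • (projPM d 1 * A * projPM d 1)) := by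
  have h1 := cast_add_one_ne_zero d
  have h3 := cast_sub_one_ne_zero hd
  have n0 := psiNorm_ne_zero hd 0
  have n1 := psiNorm_ne_zero hd 1
  subst hA
  rw [block, projBeta_eq, projGamma_eq]
  simp only [linkC_add, linkC_smul, linkC_sub, alphaBlock_eq, Fin.sum_univ_two, linkC_psiUnit,
    linkC_projABC _ hE, psiNorm_zero_mul_self hd, psiNorm_one_mul_self hd]
  simp only [Matrix.single_apply_same, mul_comm (psiNorm d 1)]
  simp
  match_scalars <;> field_simp <;> ring

theorem sum_vonNeumannA {d : ℕ} (U : SU d) : ∑ k, vonNeumannA U k = 1 := by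
  have : ∑ k, vonNeumannA U k = (∑ k, vonNeumann U k) ⊗ₖ (1 : Matrix (Fin d) (Fin d) ℂ) := by
    ext x y
    simp [vonNeumannA, Matrix.sum_apply, Finset.sum_mul]
  rw [this, sum_vonNeumann, Matrix.one_kronecker_one]

/-- The classical results `k ≠ i` contribute `β` terms that are affine in `E_k` with a common
coefficient, so completeness expresses their sum through `E_i` alone. -/
theorem replicated_diag {d : ℕ} (hd : 2 ≤ d) (U : SU d) (i : Fin d) :
    replicated (learningInstrument d (optParam d)) U (i, i) =
      ((16 * (d : ℂ) - 2) / (9 * d * ((d : ℂ) ^ 2 - 1))) •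
          (projPM d 0 * vonNeumannA U i * projPM d 0) +
        (((d : ℂ) ^ 2 - 3) / (d * ((d : ℂ) ^ 2 - 1))) • projPM d 0 := by
  have h0 := cast_ne_zero hd
  have h1 := cast_add_one_ne_zero d
  have h3 := cast_sub_one_ne_zero hd
  have hk : ∀ k ∈ Finset.univ.erase i, linkC (diagBlock d (optParam d) i i k) (vonNeumann U k) =
      (1 / ((d : ℂ) * (d - 1))) • (projPM d 0 - (2 / ((d : ℂ) + 1)) •
        (projPM d 0 * vonNeumannA U k * projPM d 0)) := by
    intro k hk
    rw [diagBlock_eq, classOf_xxy (Finset.ne_of_mem_erase hk).symm, linkC_smul,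
      linkC_block hd _ _ _ (trace_vonNeumann U k) (vonNeumannA U k) rfl]
    simp only [sAlpha, sBeta, sGamma, classCard, Matrix.zero_apply]
    match_scalars <;> field_simp <;> simp
  have hs : ∑ k ∈ Finset.univ.erase i, projPM d 0 * vonNeumannA U k * projPM d 0 =
      projPM d 0 - projPM d 0 * vonNeumannA U i * projPM d 0 := by
    rw [← Finset.sum_mul, ← Finset.mul_sum, eq_sub_iff_add_eq, ← add_mul, ← mul_add, add_comm,
      Finset.add_sum_erase _ _ (Finset.mem_univ i), sum_vonNeumannA, mul_one, projPM_mul, if_pos rfl]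
  rw [replicated_learningInstrument, ← Finset.add_sum_erase _ _ (Finset.mem_univ i),
    Finset.sum_congr rfl hk, ← Finset.smul_sum, Finset.sum_sub_distrib, ← Finset.smul_sum, hs,
    Finset.sum_const, Finset.card_erase_of_mem (Finset.mem_univ i), Finset.card_univ,
    Fintype.card_fin, ← Nat.cast_smul_eq_nsmul ℂ, Nat.cast_sub (by omega),
    diagBlock_eq, classOf_xxx, linkC_smul, linkC_block hd _ _ _ (trace_vonNeumann U i) (vonNeumannA U i) rfl,
    sq_sub_one]
  simp only [sAlpha, sBeta, sGamma, classCard, optParam]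
  simp
  match_scalars <;> field_simp <;> ring

theorem scalar_mul_self {d : ℕ} (hd : 2 ≤ d) :
    (1 / ((√(9 * (d : ℝ) * ((d : ℝ) - 1)) : ℝ) : ℂ)) * (1 / ((√(9 * (d : ℝ) * ((d : ℝ) - 1)) : ℝ) : ℂ)) =
      1 / (9 * d * (d - 1)) := by
  have hd' : (2 : ℝ) ≤ d := by exact_mod_cast hd
  have h1 : (0 : ℝ) < d - 1 := by linarith
  rw [div_mul_div_comm, ← Complex.ofReal_mul, Real.mul_self_sqrt (by positivity)]
  push_cast; ring

/-- The results `k = i` and `k = j` give the core, the others give `γ` terms summed by completeness.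
The factor `1/(d - 2)` is left uncancelled so that one formula also covers `d = 2`. -/
theorem replicated_offDiag {d : ℕ} (hd : 2 ≤ d) (U : SU d) {i j : Fin d} (hij : i ≠ j) :
    replicated (learningInstrument d (optParam d)) U (i, j) = offDiagCore U i j +
      (1 / ((d : ℂ) * (d - 1) * (d - 2))) • (((d : ℂ) - 2) • projPM d 1 - (2 / ((d : ℂ) - 1)) •
        (projPM d 1 - projPM d 1 * (vonNeumannA U i + vonNeumannA U j) * projPM d 1)) := by
  have h0 := cast_ne_zero hd
  have h1 := cast_add_one_ne_zero d
  have h3 := cast_sub_one_ne_zero hd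
  have n0 := psiNorm_ne_zero hd 0
  have n1 := psiNorm_ne_zero hd 1
  have hj : j ∈ Finset.univ.erase i := Finset.mem_erase.2 ⟨hij.symm, Finset.mem_univ j⟩
  have hk : ∀ k ∈ (Finset.univ.erase i).erase j,
      linkC (diagBlock d (optParam d) i j k) (vonNeumann U k) =
      (1 / ((d : ℂ) * (d - 1) * (d - 2))) • (projPM d 1 - (2 / ((d : ℂ) - 1)) •
        (projPM d 1 * vonNeumannA U k * projPM d 1)) := by
    intro k hk
    rw [diagBlock_eq, classOf_xyz hij (Finset.ne_of_mem_erase (Finset.mem_of_mem_erase hk)).symm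
      (Finset.ne_of_mem_erase hk).symm, linkC_smul,
      linkC_block hd _ _ _ (trace_vonNeumann U k) (vonNeumannA U k) rfl]
    simp only [sAlpha, sBeta, sGamma, classCard, Matrix.zero_apply]
    have : (d : ℂ) / (d * (d - 1) * (d - 2)) * (1 / d) = 1 / (d * (d - 1) * (d - 2)) := by
      rw [div_mul_div_comm, mul_one, mul_comm _ (d : ℂ), div_mul_cancel_left₀ h0, one_div]
    rw [← this, mul_smul]
    simp
  have hs : ∑ k ∈ (Finset.univ.erase i).erase j, projPM d 1 * vonNeumannA U k * projPM d 1 =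
      projPM d 1 - projPM d 1 * (vonNeumannA U i + vonNeumannA U j) * projPM d 1 := by
    rw [← Finset.sum_mul, ← Finset.mul_sum, eq_sub_iff_add_eq, ← add_mul, ← mul_add, add_comm,
      add_assoc, Finset.add_sum_erase _ _ hj,
      Finset.add_sum_erase _ _ (Finset.mem_univ i), sum_vonNeumannA, mul_one, projPM_mul, if_pos rfl]
  -- The rank one blocks with weights `(1, 3)` and `(1, -3)` become conjugation by `P^+ + 3 P^-` and
  -- `P^+ - 3 P^-`.
  have hcore : linkC (diagBlock d (optParam d) i j i) (vonNeumann U i) +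
      linkC (diagBlock d (optParam d) i j j) (vonNeumann U j) = offDiagCore U i j := by
    rw [diagBlock_eq, diagBlock_eq, classOf_xyx hij, classOf_xyy hij, linkC_smul, linkC_smul,
      linkC_block hd _ _ _ (trace_vonNeumann U i) (vonNeumannA U i) rfl,
      linkC_block hd _ _ _ (trace_vonNeumann U j) (vonNeumannA U j) rfl, sAlpha_xyx hd, sAlpha_xyy hd, offDiagCore,
      qPM, qPM]
    simp only [Matrix.smul_mul, Matrix.mul_smul, smul_smul, scalar_mul_self hd]
    simp only [sBeta, sGamma, classCard, rankOne]
    simp only [add_mul, mul_add, Matrix.smul_mul, Matrix.mul_smul]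
    simp
    match_scalars <;> field_simp <;> norm_num
  rw [replicated_learningInstrument, ← Finset.add_sum_erase _ _ (Finset.mem_univ i),
    ← Finset.add_sum_erase _ _ hj, Finset.sum_congr rfl hk, ← Finset.smul_sum,
    Finset.sum_sub_distrib, ← Finset.smul_sum, hs,
    Finset.sum_const, Finset.card_erase_of_mem hj, Finset.card_erase_of_mem (Finset.mem_univ i),
    Finset.card_univ, Fintype.card_fin, ← Nat.cast_smul_eq_nsmul ℂ, ← add_assoc, hcore, Nat.sub_sub,
    Nat.cast_sub (by omega)]
  norm_num

/-! ### Closed forms and asymptotics of the optimal value -/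

theorem dualValue_eq {d : ℕ} (hd : 3 ≤ d) :
    dualValue d = (9 * (d : ℝ) ^ 2 + 16 * d - 17) / (6 * (d : ℝ) ^ 2 * ((d : ℝ) ^ 2 - 1)) := by
  have hd' : (3 : ℝ) ≤ d := by exact_mod_cast hd
  have h0 : (d : ℝ) ≠ 0 := by linarith
  have h1 : (d : ℝ) + 1 ≠ 0 := by linarith
  have h2 : (d : ℝ) - 1 ≠ 0 := by linarith
  have h3 : (d : ℝ) + 2 ≠ 0 := by linarith
  have h4 : (d : ℝ) - 2 ≠ 0 := by linarith
  rw [dualValue, show (d : ℝ) ^ 2 - 1 = (d + 1) * (d - 1) by ring]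
  field_simp
  ring

/-- The `γ` term drops out through `1/0 = 0`, in agreement with `P^γ = 0`. -/
theorem dualValue_two : dualValue 2 = 7 / 12 := by norm_num [dualValue]

theorem isEquivalent_sSup_learningFidelities :
    Asymptotics.IsEquivalent Filter.atTop (fun d : ℕ => sSup (learningFidelities d))
      (fun d : ℕ => 3 / (2 * (d : ℝ) ^ 2)) := by
  have h0 : ∀ᶠ d : ℕ in Filter.atTop, (3 : ℝ) / (2 * (d : ℝ) ^ 2) ≠ 0 := by
    filter_upwards [Filter.eventually_ge_atTop 1] with d hd
    have : (0 : ℝ) < d := by exact_mod_cast hd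
    positivity
  rw [Asymptotics.isEquivalent_iff_tendsto_one h0]
  have h1 := tendsto_const_div_atTop_nhds_zero_nat (16 : ℝ)
  have h2 := tendsto_const_div_atTop_nhds_zero_nat (17 : ℝ)
  have h3 := tendsto_const_div_atTop_nhds_zero_nat (1 : ℝ)
  -- This is the ratio of the optimal value to `3/(2d²)`, written in powers of `1/d`.
  have h : Filter.Tendsto (fun d : ℕ => (9 + 16 / (d : ℝ) - 17 / (d : ℝ) * (1 / (d : ℝ))) /
      (9 * (1 - 1 / (d : ℝ) * (1 / (d : ℝ))))) Filter.atTop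
      (nhds ((9 + 0 - 0 * 0) / (9 * (1 - 0 * 0)))) :=
    ((h1.const_add 9).sub (h2.mul h3)).div (((h3.mul h3).const_sub 1).const_mul 9) (by norm_num)
  norm_num at h
  refine h.congr' ?_
  filter_upwards [Filter.eventually_ge_atTop 3] with d hd
  have hd' : (3 : ℝ) ≤ d := by exact_mod_cast hd
  have e0 : (d : ℝ) ≠ 0 := by linarith
  have e1 : (d : ℝ) ^ 2 - 1 ≠ 0 := by nlinarith
  rw [Pi.div_apply, (isGreatest_learningFidelities (by omega)).csSup_eq, dualValue_eq hd]
  field_simp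
  ring

end MeasurementLearning

end

theorem mainTheorem2 :
    -- the optimal fidelity
    (∀ d : ℕ, 3 ≤ d → IsGreatest (MeasurementLearning.learningFidelities d)
      ((9 * (d : ℝ) ^ 2 + 16 * d - 17) / (6 * (d : ℝ) ^ 2 * ((d : ℝ) ^ 2 - 1)))) ∧
    IsGreatest (MeasurementLearning.learningFidelities 2) (7 / 12 : ℝ) ∧
    -- its asymptotic behaviour
    Asymptotics.IsEquivalent Filter.atTop
      (fun d : ℕ => sSup (MeasurementLearning.learningFidelities d))
      (fun d : ℕ => 3 / (2 * (d : ℝ) ^ 2)) ∧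
    -- the explicit instrument is a learning strategy and is optimal
    (∀ d : ℕ, 2 ≤ d →
      MeasurementLearning.IsLearningInstrument
        (MeasurementLearning.learningInstrument d (MeasurementLearning.optParam d)) ∧
      IsGreatest (MeasurementLearning.learningFidelities d)
        (MeasurementLearning.averageFidelity
          (MeasurementLearning.learningInstrument d (MeasurementLearning.optParam d)))) ∧
    -- the POVMs that it replicates: equal outcomes
    (∀ d : ℕ, 2 ≤ d → ∀ (U : MeasurementLearning.SU d) (i : Fin d),
      MeasurementLearning.replicated
          (MeasurementLearning.learningInstrument d (MeasurementLearning.optParam d)) U (i, i) =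
        ((16 * (d : ℂ) - 2) / (9 * d * ((d : ℂ) ^ 2 - 1))) •
          (MeasurementLearning.projPM d 0 * MeasurementLearning.vonNeumannA U i *
            MeasurementLearning.projPM d 0) +
        (((d : ℂ) ^ 2 - 3) / (d * ((d : ℂ) ^ 2 - 1))) • MeasurementLearning.projPM d 0) ∧
    -- different outcomes, in dimension at least three
    (∀ d : ℕ, 3 ≤ d → ∀ (U : MeasurementLearning.SU d) (i j : Fin d), i ≠ j →
      MeasurementLearning.replicated
          (MeasurementLearning.learningInstrument d (MeasurementLearning.optParam d)) U (i, j) =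
        MeasurementLearning.offDiagCore U i j +
        (2 / ((d : ℂ) * ((d : ℂ) - 1) ^ 2 * ((d : ℂ) - 2))) •
          (MeasurementLearning.projPM d 1 *
            (MeasurementLearning.vonNeumannA U i + MeasurementLearning.vonNeumannA U j) *
            MeasurementLearning.projPM d 1) +
        (((d : ℂ) - 3) / (((d : ℂ) - 1) ^ 2 * ((d : ℂ) - 2))) • MeasurementLearning.projPM d 1) ∧
    -- different outcomes, in dimension two
    (∀ (U : MeasurementLearning.SU 2) (i j : Fin 2), i ≠ j →
      MeasurementLearning.replicated
          (MeasurementLearning.learningInstrument 2 (MeasurementLearning.optParam 2)) U (i, j) =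
        MeasurementLearning.offDiagCore U i j) := by
  refine ⟨fun d hd => ?_, ?_, MeasurementLearning.isEquivalent_sSup_learningFidelities,
    fun d hd => ⟨MeasurementLearning.isLearningInstrument_learningInstrument hd, ?_⟩,
    fun d hd U i => MeasurementLearning.replicated_diag hd U i, fun d hd U i j hij => ?_,
    fun U i j hij => ?_⟩
  · rw [← MeasurementLearning.dualValue_eq hd]
    exact MeasurementLearning.isGreatest_learningFidelities (by omega)
  · rw [← MeasurementLearning.dualValue_two]
    exact MeasurementLearning.isGreatest_learningFidelities le_rfl
  · rw [MeasurementLearning.averageFidelity_learningInstrument hd]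
    exact MeasurementLearning.isGreatest_learningFidelities hd
  · have h0 := MeasurementLearning.cast_ne_zero (show 2 ≤ d by omega)
    have h1 := MeasurementLearning.cast_sub_one_ne_zero (show 2 ≤ d by omega)
    have h2 := MeasurementLearning.cast_sub_two_ne_zero hd
    rw [MeasurementLearning.replicated_offDiag (by omega) U hij]
    match_scalars <;> field_simp <;> ring
  -- For `d = 2` the scalar `1/(d(d-1)(d-2))` is `1/0 = 0`, which leaves only the core.
  · rw [MeasurementLearning.replicated_offDiag le_rfl U hij]
    simp
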